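/- **Definitions.** A (finite) graph is a (finite) set $V(A)$ with a reflexive symmetric edge relation $E(A)\subseteq V(A)^2$. An epimorphism is a map of vertices that preserves edges and is onto on vertices and on edges. A set of vertices is connected if it is not a union of two nonempty sets with no edge between them; components are maximal connected subsets. An epimorphism $f\colon G\to H$ is confluent if $f(C)=Q$ for every connected $Q\subseteq V(H)$ and every component $C$ of $f^{-1}(Q)$. A cycle is a graph with $n\ge 3$ vertices $c_0,\dots,c_{n-1}$ in which distinct vertices are adjacent exactly when they are cyclically consecutive. The winding number of a confluent epimorphism $f$ between cycles is the number of components of $f^{-1}(c)$, which is the same for every vertex $c$. A projective Fraïssé class $\mathcal D$ is a class of finite graphs together with a fixed class of epimorphisms between its members ("the epimorphisms of $\mathcal D$") such that: (1) $\mathcal D$ is countable up to isomorphism, where $A,B$ are isomorphic if there are mutually inverse epimorphisms of $\mathcal D$ between them; (2) the epimorphisms of $\mathcal D$ contain the identities and are closed under composition; (3) any $B,C\in\mathcal D$ admit epimorphisms of $\mathcal D$ from some common $E\in\mathcal D$; (4) for epimorphisms $f\colon B\to A$, $g\colon C\to A$ of $\mathcal D$ there are $E\in\mathcal D$ and epimorphisms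 $f_0\colon E\to B$, $g_0\colon E\to C$ of $\mathcal D$ with $f f_0=g g_0$. A topological graph is a zero-dimensional compact metrizable space with a closed, reflexive, symmetric edge relation. The projective Fraïssé limit $\mathbb D$ of $\mathcal D$ is a topological graph isomorphic to an inverse limit (edges taken coordinatewise) of a sequence $\{F_n,\alpha_n\}$ of members and epimorphisms of $\mathcal D$ such that, calling a map $\mathbb D\to A$ ($A\in\mathcal D$) admissible if it is a projection $\mathbb D\to F_n$ followed by an epimorphism $F_n\to A$ of $\mathcal D$: every $A\in\mathcal D$ is the image of an admissible map; for every admissible $f\colon\mathbb D\to A$ and every epimorphism $g\colon B\to A$ of $\mathcal D$ there is an admissible $h\colon\mathbb D\to B$ with $f=gh$; and for every $\varepsilon>0$ there is an admissible map all of whose fibres have diameter less than $\varepsilon$. If $E(\mathbb D)$ is transitive, the topological realization $|\mathbb D|$ is the quotient space $\mathbb D/E(\mathbb D)$. A solenoid is a space homeomorphic to $\varprojlim\{S^1,z^{n_i}\}$ for some integers $n_i\ge 1$ (so the circle counts as the trivial solenoid); a nontrivial solenoid is one for which all $n_i\ge 2$ can be taken. **Proposition.** Let $\mathcal D$ be a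 projective Fraïssé class of cycles with confluent epimorphisms (not necessarily all cycles, nor all confluent epimorphisms between its members). Suppose that - for every $C\in\mathcal D$ there is an epimorphism $f\colon B\to C$ of $\mathcal D$ such that for every $x\in C$ every component of $f^{-1}(x)$ has at least two vertices, and - the set $W_{\mathcal D}$ of winding numbers of epimorphisms of $\mathcal D$ is infinite. Then $\mathcal D$ has a projective Fraïssé limit, and for the projective Fraïssé limit $\mathbb D$ the relation $E(\mathbb D)$ is transitive, so that $|\mathbb D|$ exists, and $|\mathbb D|$ is a solenoid. If moreover, for some single $C\in\mathcal D$, infinitely many integers are winding numbers of epimorphisms of $\mathcal D$ onto $C$, then $|\mathbb D|$ is a nontrivial solenoid. -/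

import Mathlib

/-!
Along cyclic enumerations, a confluent epimorphism between cycles lifts to a monotone map of `ℤ`
with steps at most one, and its degree is the winding number. If all components of vertex fibres
have at least two vertices, the lift does not rise twice in a row.

Passing to a subsequence, all bonding maps of the inverse sequence have this property. Take circles
of circumference the products of the degrees, so that the power maps of the solenoid are local
isometries, and subdivide them compatibly with the lifts, with one arc for each vertex. As each arc
is refined by at least two, the mesh tends to zero. Relate a thread `x` to a point `z` of the
solenoid if every `z i` lies on the arc of `x i`: this is a closed relation, and it is the graph of
a continuous surjection whose fibres are exactly the adjacency classes. So transitivity of the edge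
relation and the homeomorphism with the solenoid come at once.

If infinitely many winding numbers occur over a single member `C`, compare an epimorphism `φ` from
a stage `p` onto `C` with an epimorphism `g` onto `C` of larger winding number. The composite of `φ`
with the bonding map from some later stage `m` factors through `g`, and winding numbers multiply, so
stage `m` winds at least twice around stage `p`. Hence all degrees can be made at least two.
-/

universe u v

namespace FraisseCycles

/-- A finite graph: a finite vertex set with a reflexive and symmetric edge relation. -/
structure FinGraph where
  V : Type u
  finite : Finite V
  Adj : V → V → Prop
  refl : ∀ a, Adj a a
  symm : ∀ a b, Adj a b → Adj b a

instance FinGraph.instFinite (A : FinGraph.{u}) : Finite A.V := A.finite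

/-- The vertex set of a finite graph carries the discrete topology. -/
instance FinGraph.instTopologicalSpace (A : FinGraph.{u}) : TopologicalSpace A.V := ⊥

instance FinGraph.instDiscreteTopology (A : FinGraph.{u}) : DiscreteTopology A.V := ⟨rfl⟩

instance FinGraph.instSecondCountableTopology (A : FinGraph.{u}) :
    SecondCountableTopology A.V := inferInstance

/-- A topological graph: a zero-dimensional compact metrizable space of vertices with a closed,
reflexive and symmetric edge relation. (A compact Hausdorff space is zero-dimensional if and only
if it is totally disconnected, and metrizable if and only if it is second countable.) -/
structure TopGraph where
  V : Type u
  top : TopologicalSpace V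
  compact : CompactSpace V
  t2 : T2Space V
  totallyDisconnected : TotallyDisconnectedSpace V
  secondCountable : SecondCountableTopology V
  Adj : V → V → Prop
  refl : ∀ a, Adj a a
  symm : ∀ a b, Adj a b → Adj b a
  closed : IsClosed {p : V × V | Adj p.1 p.2}

instance TopGraph.instTopologicalSpace (K : TopGraph.{u}) : TopologicalSpace K.V := K.top

/-- An isomorphism of topological graphs. -/
def TopGraph.Isomorphic (K : TopGraph.{u}) (L : TopGraph.{v}) : Prop :=
  ∃ e : K.V ≃ₜ L.V, ∀ x y, K.Adj x y ↔ L.Adj (e x) (e y)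

section FiniteGraphs

variable {A B : FinGraph.{u}}

/-- An epimorphism: edges go to edges, and the map is onto on vertices and on edges. -/
def IsEpimorphism (f : A.V → B.V) : Prop :=
  (∀ a a', A.Adj a a' → B.Adj (f a) (f a')) ∧
  Function.Surjective f ∧
  (∀ b b', B.Adj b b' → ∃ a a', A.Adj a a' ∧ f a = b ∧ f a' = b')

/-- A set of vertices is connected if it is not the union of two nonempty sets without any edge
between them. (Such sets are disjoint, because the edge relation is reflexive.) -/
def IsConnectedSet (S : Set A.V) : Prop :=
  ¬ ∃ P Q : Set A.V, P.Nonempty ∧ Q.Nonempty ∧ P ∪ Q = S ∧ ∀ a ∈ P, ∀ b ∈ Q, ¬ A.Adj a b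

/-- The component of `S` containing `a`. -/
def component (S : Set A.V) (a : A.V) : Set A.V :=
  ⋃₀ {P : Set A.V | P ⊆ S ∧ a ∈ P ∧ IsConnectedSet P}

/-- `C` is a component of `S`. -/
def IsComponent (S C : Set A.V) : Prop :=
  ∃ a ∈ S, C = component S a

/-- Confluence: every component of the preimage of a connected set `Q` is mapped onto `Q`. -/
def IsConfluent (f : A.V → B.V) : Prop :=
  ∀ Q : Set B.V, IsConnectedSet Q → ∀ C : Set A.V, IsComponent (f ⁻¹' Q) C → f '' C = Q

/-- `n` is the winding number of `f`: each vertex fibre has exactly `n` components. -/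
def HasWindingNumber (f : A.V → B.V) (n : ℕ) : Prop :=
  ∀ b : B.V, {C : Set A.V | IsComponent (f ⁻¹' {b}) C}.ncard = n

end FiniteGraphs

/-- A cycle: at least three vertices, cyclically enumerated without repetition, where two distinct
vertices are adjacent exactly when they are cyclically consecutive. -/
def IsCycle (A : FinGraph.{u}) : Prop :=
  ∃ n : ℕ, 3 ≤ n ∧ ∃ c : ZMod n ≃ A.V,
    ∀ i j : ZMod n, A.Adj (c i) (c j) ↔ (i = j ∨ j = i + 1 ∨ i = j + 1)

/-- A class of finite graphs with a fixed class of epimorphisms between its members. -/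
structure GraphClass where
  obj : Set FinGraph.{u}
  epi : ∀ A B : FinGraph.{u}, Set (A.V → B.V)
  isEpimorphism : ∀ A ∈ obj, ∀ B ∈ obj, ∀ f ∈ epi A B, IsEpimorphism f

namespace GraphClass

/-- `A` and `B` are isomorphic in the class `D`: there are mutually inverse maps between them that
both belong to `D`. (They are then isomorphisms of graphs.) -/
def Isomorphic (D : GraphClass.{u}) (A B : FinGraph.{u}) : Prop :=
  ∃ f ∈ D.epi A B, ∃ g ∈ D.epi B A, g ∘ f = id ∧ f ∘ g = id

/-- Projective Fraïssé classes. -/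
structure IsProjectiveFraisse (D : GraphClass.{u}) : Prop where
  countable : ∀ S : Set FinGraph.{u}, S ⊆ D.obj →
    S.Pairwise (fun A B => ¬ D.Isomorphic A B) → S.Countable
  id_mem : ∀ A ∈ D.obj, id ∈ D.epi A A
  comp_mem : ∀ A ∈ D.obj, ∀ B ∈ D.obj, ∀ C ∈ D.obj, ∀ f ∈ D.epi A B, ∀ g ∈ D.epi B C,
    g ∘ f ∈ D.epi A C
  joint : ∀ B ∈ D.obj, ∀ C ∈ D.obj, ∃ E ∈ D.obj, (D.epi E B).Nonempty ∧ (D.epi E C).Nonempty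
  amalgamation : ∀ A ∈ D.obj, ∀ B ∈ D.obj, ∀ C ∈ D.obj, ∀ f ∈ D.epi B A, ∀ g ∈ D.epi C A,
    ∃ E ∈ D.obj, ∃ f₀ ∈ D.epi E B, ∃ g₀ ∈ D.epi E C, f ∘ f₀ = g ∘ g₀

/-- A class of cycles with confluent epimorphisms (not necessarily all cycles, nor all confluent
epimorphisms between them). -/
def IsClassOfCycles (D : GraphClass.{u}) : Prop :=
  (∀ A ∈ D.obj, IsCycle A) ∧
  (∀ A ∈ D.obj, ∀ B ∈ D.obj, ∀ f ∈ D.epi A B, IsConfluent f)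

/-- Every member `C` has a preimage in the class, under a map of the class, such that every
component of every vertex fibre has at least two vertices. -/
def HasThickPreimages (D : GraphClass.{u}) : Prop :=
  ∀ C ∈ D.obj, ∃ B ∈ D.obj, ∃ f ∈ D.epi B C,
    ∀ x : C.V, ∀ K : Set B.V, IsComponent (f ⁻¹' {x}) K → 2 ≤ K.ncard

/-- The set of winding numbers of the epimorphisms of the class onto the member `C`. -/
def windingNumbersOnto (D : GraphClass.{u}) (C : FinGraph.{u}) : Set ℕ :=
  {n | ∃ B ∈ D.obj, ∃ f ∈ D.epi B C, HasWindingNumber f n}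

/-- The set of winding numbers of all epimorphisms of the class. -/
def windingNumbers (D : GraphClass.{u}) : Set ℕ :=
  {n | ∃ C ∈ D.obj, n ∈ D.windingNumbersOnto C}

/-- An inverse sequence of members of the class, with bonding maps in the class. -/
structure InverseSequence (D : GraphClass.{u}) where
  F : ℕ → FinGraph.{u}
  F_mem : ∀ n, F n ∈ D.obj
  α : ∀ n, (F (n + 1)).V → (F n).V
  α_mem : ∀ n, α n ∈ D.epi (F (n + 1)) (F n)

namespace InverseSequence

variable {D : GraphClass.{u}}

/-- The vertices of the inverse limit, with the topology of a subspace of the product. -/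
abbrev Thread (S : D.InverseSequence) : Type u :=
  {x : ∀ n, (S.F n).V // ∀ n, S.α n (x (n + 1)) = x n}

theorem isClosed_threads (S : D.InverseSequence) :
    IsClosed {x : ∀ n, (S.F n).V | ∀ n, S.α n (x (n + 1)) = x n} := by
  simp only [Set.ofPred_forall]
  refine isClosed_iInter fun n => ?_
  exact isClosed_eq (continuous_of_discreteTopology.comp (continuous_apply (n + 1)))
    (continuous_apply n)

/-- The inverse limit of an inverse sequence, as a topological graph: two threads are adjacent if
and only if all their coordinates are. -/
def limit (S : D.InverseSequence) : TopGraph.{u} where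
  V := S.Thread
  top := inferInstance
  compact := isCompact_iff_compactSpace.mp S.isClosed_threads.isCompact
  t2 := inferInstance
  totallyDisconnected := inferInstance
  secondCountable := Topology.IsInducing.subtypeVal.secondCountableTopology
  Adj x y := ∀ n, (S.F n).Adj (x.1 n) (y.1 n)
  refl x n := (S.F n).refl (x.1 n)
  symm x y h n := (S.F n).symm _ _ (h n)
  closed := by
    simp only [Set.ofPred_forall]
    refine isClosed_iInter fun n => ?_
    have hc : Continuous (fun p : S.Thread × S.Thread => (p.1.1 n, p.2.1 n)) :=
      ((continuous_apply n).comp (continuous_subtype_val.comp continuous_fst)).prodMk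
        ((continuous_apply n).comp (continuous_subtype_val.comp continuous_snd))
    exact (isClosed_discrete {q : (S.F n).V × (S.F n).V | (S.F n).Adj q.1 q.2}).preimage hc

/-- The epimorphisms from the inverse limit onto a finite graph `A` that belong to the class, in
the usual extension of the fixed class of epimorphisms to inverse limits: those that factor as a
projection to some stage followed by an epimorphism of the class. -/
def IsClassEpi (S : D.InverseSequence) (A : FinGraph.{u}) (f : S.limit.V → A.V) : Prop :=
  ∃ n, ∃ φ ∈ D.epi (S.F n) A, ∀ x : S.Thread, f x = φ (x.1 n)

/-- The three properties that characterize the projective Fraïssé limit. In the third one, the set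
`U` takes the role of the set of pairs of points at distance less than `ε`. -/
structure IsLimiting (S : D.InverseSequence) : Prop where
  onto : ∀ A ∈ D.obj, ∃ f, S.IsClassEpi A f
  lifting : ∀ A ∈ D.obj, ∀ B ∈ D.obj, ∀ f, S.IsClassEpi A f → ∀ g ∈ D.epi B A,
    ∃ h, S.IsClassEpi B h ∧ f = g ∘ h
  refining : ∀ U : Set (S.limit.V × S.limit.V), IsOpen U → (∀ x, (x, x) ∈ U) →
    ∃ A ∈ D.obj, ∃ f, S.IsClassEpi A f ∧ ∀ x y, f x = f y → (x, y) ∈ U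

end InverseSequence

/-- `K` is the projective Fraïssé limit of the class `D`. -/
def IsProjectiveFraisseLimit (D : GraphClass.{u}) (K : TopGraph.{v}) : Prop :=
  ∃ S : D.InverseSequence, K.Isomorphic S.limit ∧ S.IsLimiting

end GraphClass

/-- The topological realization of `K`, which exists if the edge relation is transitive, hence an
equivalence relation: the quotient space of the space of vertices by the edge relation. -/
abbrev TopGraph.Realization (K : TopGraph.{u}) (h : ∀ a b c, K.Adj a b → K.Adj b c → K.Adj a c) :
    Type u :=
  Quotient (⟨K.Adj, K.refl, fun {a b} => K.symm a b, fun {a b c} => h a b c⟩ : Setoid K.V)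

/-- The inverse limit of the unit circles with the bonding maps `z ↦ z ^ (n i)`. -/
abbrev SolenoidSpace (n : ℕ → ℕ) : Type :=
  {z : ℕ → Circle // ∀ i, z (i + 1) ^ (n i) = z i}

/-- A solenoid: the inverse limit of circles with bonding maps `z ↦ z ^ (n i)`, `n i ≥ 1`.
The circle is included, as the trivial solenoid. -/
def IsSolenoid (X : Type u) [TopologicalSpace X] : Prop :=
  ∃ n : ℕ → ℕ, (∀ i, 1 ≤ n i) ∧ Nonempty (X ≃ₜ SolenoidSpace n)

/-- A solenoid other than the circle: all exponents can be taken to be at least two. -/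
def IsNontrivialSolenoid (X : Type u) [TopologicalSpace X] : Prop :=
  ∃ n : ℕ → ℕ, (∀ i, 2 ≤ n i) ∧ Nonempty (X ≃ₜ SolenoidSpace n)

section IntegerFunctions

theorem map_add_int_mul {G : Type*} [AddGroup G] {F : ℤ → G} {m : ℤ} {c : G}
    (h : ∀ k, F (k + m) = F k + c) (k r : ℤ) : F (k + r * m) = F k + r • c :=
  AddConstMapClass.map_add_zsmul (⟨F, h⟩ : AddConstMap ℤ G m c) k r

theorem exists_antidifference {G : Type*} [AddCommGroup G] (d : ℤ → G) (a : G) :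
    ∃ F : ℤ → G, F 0 = a ∧ ∀ k, F (k + 1) = F k + d k := by
  refine ⟨fun k => k.inductionOn' 0 a (fun k _ x => x + d k) (fun k _ x => x - d (k - 1)),
    Int.inductionOn'_self, fun k => ?_⟩
  rcases le_or_gt 0 k with hk | hk
  · exact Int.inductionOn'_add_one hk
  · have hpred := Int.inductionOn'_sub_one (motive := fun _ => G) (zero := a)
      (succ := fun k _ x => x + d k) (pred := fun k _ x => x - d (k - 1)) (show k + 1 ≤ 0 from hk)
    simp only [add_sub_cancel_right] at hpred
    exact (sub_eq_iff_eq_add.1 hpred.symm)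

theorem exists_galoisConnection_of_periodic {F : ℤ → ℤ} (hF : Monotone F) {m c : ℤ} (hc : 0 < c)
    (h : ∀ k, F (k + m) = F k + c) : ∃ s : ℤ → ℤ, GaloisConnection s F := by
  have hle (j : ℤ) : ∃ k, j ≤ F k := by
    refine ⟨0 + |j - F 0| * m, ?_⟩
    rw [map_add_int_mul h, smul_eq_mul]
    nlinarith [le_abs_self (j - F 0), abs_nonneg (j - F 0)]
  have hbdd (j : ℤ) : ∃ b, ∀ k, j ≤ F k → b ≤ k := by
    refine ⟨0 + -(|F 0 - j| + 1) * m, fun k hk => ?_⟩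
    by_contra! hlt
    have := hF hlt.le
    rw [map_add_int_mul h, smul_eq_mul] at this
    nlinarith [le_abs_self (F 0 - j), abs_nonneg (F 0 - j)]
  choose s hs hmin using fun j => Int.exists_least_of_bdd (hbdd j) (hle j)
  exact ⟨s, fun j k => ⟨fun hjk => (hs j).trans (hF hjk), hmin j k⟩⟩

end IntegerFunctions

section Components

variable {A B C : FinGraph.{u}} {S T : Set A.V}

theorem isConnectedSet_iff : IsConnectedSet S ↔ ∀ T, (S ∩ T).Nonempty →
    (∀ a ∈ S ∩ T, ∀ b ∈ S \ T, ¬ A.Adj a b) → S ⊆ T := by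
  constructor
  · intro hS T hT hno
    by_contra hST
    exact hS ⟨S ∩ T, S \ T, hT, Set.sdiff_nonempty.2 hST, Set.inter_union_sdiff S T, hno⟩
  · rintro h ⟨P, Q, ⟨p, hp⟩, ⟨q, hq⟩, rfl, hno⟩
    have hsub : P ∪ Q ⊆ P := h P ⟨p, Or.inl hp, hp⟩ fun a ha b hb =>
      hno a ha.2 b (hb.1.resolve_left hb.2)
    exact hno q (hsub (Or.inr hq)) q hq (A.refl q)

theorem isConnectedSet_pair {a b : A.V} (h : A.Adj a b) : IsConnectedSet ({a, b} : Set A.V) := by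
  refine isConnectedSet_iff.2 fun T ⟨x, hx, hxT⟩ hno y hy => by_contra fun hyT => ?_
  refine hno x ⟨hx, hxT⟩ y ⟨hy, hyT⟩ ?_
  rcases hx with rfl | rfl <;> rcases hy with rfl | rfl
  exacts [A.refl _, h, A.symm _ _ h, A.refl _]

theorem component_subset {a : A.V} (ha : a ∈ T) (h : ∀ x ∈ S ∩ T, ∀ y ∈ S \ T, ¬ A.Adj x y) :
    component S a ⊆ T := by
  rintro y ⟨P, ⟨hPS, haP, hP⟩, hyP⟩
  exact isConnectedSet_iff.1 hP T ⟨a, haP, ha⟩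
    (fun x hx z hz => h x ⟨hPS hx.1, hx.2⟩ z ⟨hPS hz.1, hz.2⟩) hyP

theorem subset_component {a : A.V} (ha : a ∈ T) (hTS : T ⊆ S) (hT : IsConnectedSet T) :
    T ⊆ component S a :=
  fun _ hy => ⟨T, ⟨hTS, ha, hT⟩, hy⟩

theorem component_subset_self (S : Set A.V) (a : A.V) : component S a ⊆ S :=
  Set.sUnion_subset fun _ hP => hP.1

theorem component_mono (h : S ⊆ T) (a : A.V) : component S a ⊆ component T a :=
  Set.sUnion_mono fun _ hP => ⟨hP.1.trans h, hP.2⟩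

theorem mem_component {a : A.V} (ha : a ∈ S) : a ∈ component S a := by
  have hconn := isConnectedSet_pair (A.refl a)
  rw [Set.pair_eq_singleton] at hconn
  exact subset_component (Set.mem_singleton a) (Set.singleton_subset_iff.2 ha) hconn rfl

theorem isConnectedSet_component (S : Set A.V) (a : A.V) : IsConnectedSet (component S a) := by
  refine isConnectedSet_iff.2 fun T ⟨y, ⟨P, hP, hyP⟩, hyT⟩ hno => ?_
  have key {R : Set A.V} (hR : R ⊆ S ∧ a ∈ R ∧ IsConnectedSet R) (hRT : (R ∩ T).Nonempty) :
      R ⊆ T :=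
    isConnectedSet_iff.1 hR.2.2 T hRT fun x hx z hz =>
      hno x ⟨⟨R, hR, hx.1⟩, hx.2⟩ z ⟨⟨R, hR, hz.1⟩, hz.2⟩
  have haT : a ∈ T := key hP ⟨y, hyP, hyT⟩ hP.2.1
  exact Set.sUnion_subset fun R hR => key hR ⟨a, hR.2.1, haT⟩

/-- The components of all vertex fibres of `f` have at least two vertices. -/
def HasThickFibres (f : A.V → B.V) : Prop :=
  ∀ x : B.V, ∀ K : Set A.V, IsComponent (f ⁻¹' {x}) K → 2 ≤ K.ncard

theorem HasThickFibres.comp_confluent {f : B.V → C.V} {g : A.V → B.V} (hf : HasThickFibres f)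
    (hg : IsConfluent g) : HasThickFibres (f ∘ g) := by
  rintro x _ ⟨a, ha, rfl⟩
  set K := component (f ⁻¹' {x}) (g a)
  have himage : g '' component (g ⁻¹' K) a = K :=
    hg K (isConnectedSet_component _ _) _ ⟨a, mem_component (S := f ⁻¹' {x}) ha, rfl⟩
  have hK : g ⁻¹' K ⊆ f ∘ g ⁻¹' {x} := Set.preimage_mono (component_subset_self _ _)
  calc 2 ≤ K.ncard := hf x K ⟨g a, ha, rfl⟩
    _ = (g '' component (g ⁻¹' K) a).ncard := by rw [himage]
    _ ≤ (component (g ⁻¹' K) a).ncard := Set.ncard_image_le (Set.toFinite _)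
    _ ≤ _ := Set.ncard_le_ncard (component_mono hK a) (Set.toFinite _)

end Components

/-- An enumeration of the vertices of a cycle by the integers, in cyclic order, whose period is the
number `size` of vertices. It serves as the universal cover of the cycle. -/
structure CyclicEnumeration (A : FinGraph.{u}) where
  size : ℕ
  toFun : ℤ → A.V
  three_le_size : 3 ≤ size
  surjective : Function.Surjective toFun
  eq_iff : ∀ i j, toFun i = toFun j ↔ (size : ℤ) ∣ j - i
  adj_iff : ∀ i v, A.Adj (toFun i) v ↔ ∃ l, |l - i| ≤ 1 ∧ toFun l = v

theorem IsCycle.nonempty_cyclicEnumeration {A : FinGraph.{u}} (hA : IsCycle A) :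
    Nonempty (CyclicEnumeration A) := by
  obtain ⟨n, hn, c, hc⟩ := hA
  refine ⟨⟨n, fun i => c i, hn, c.surjective.comp ZMod.intCast_surjective, fun i j => ?_,
    fun i v => ?_⟩⟩
  · rw [c.injective.eq_iff, ZMod.intCast_eq_intCast_iff_dvd_sub]
  obtain ⟨j, rfl⟩ := c.surjective v
  simp only [hc, c.injective.eq_iff]
  constructor
  · rintro (rfl | rfl | h)
    · exact ⟨i, by simp⟩
    · exact ⟨i + 1, by simp⟩
    · exact ⟨i - 1, by simp [h]⟩
  · rintro ⟨l, hl, rfl⟩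
    obtain rfl | rfl | rfl : l = i ∨ l = i + 1 ∨ l = i - 1 := by rw [abs_le] at hl; lia
    all_goals simp

namespace CyclicEnumeration

variable {A : FinGraph.{u}}

instance : CoeFun (CyclicEnumeration A) fun _ => ℤ → A.V := ⟨toFun⟩

variable (e : CyclicEnumeration A)

/-- The same cycle enumerated in the opposite direction. -/
def neg : CyclicEnumeration A where
  size := e.size
  toFun k := e (-k)
  three_le_size := e.three_le_size
  surjective := e.surjective.comp neg_surjective
  eq_iff i j := by rw [e.eq_iff, ← dvd_neg, neg_sub_neg, neg_sub]
  adj_iff i v := by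
    rw [e.adj_iff, ← (Equiv.neg ℤ).exists_congr_right]
    simp only [Equiv.neg_apply, neg_sub_neg, abs_sub_comm i]

theorem size_pos : (0 : ℤ) < e.size := by
  have := e.three_le_size
  omega

variable {e} {i j : ℤ}

theorem apply_add_eq_iff (d : ℤ) : e (i + d) = e (j + d) ↔ e i = e j := by
  rw [e.eq_iff, e.eq_iff, add_sub_add_right_eq_sub]

theorem apply_add_mul_size (r : ℤ) : e (i + r * e.size) = e i :=
  ((e.eq_iff _ _).2 ⟨r, by ring⟩).symm

theorem eq_of_abs_sub_le_two (h : e i = e j) (hij : |j - i| ≤ 2) : i = j := by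
  have := Int.eq_zero_of_abs_lt_dvd ((e.eq_iff i j).1 h) (by have := e.three_le_size; omega)
  omega

theorem adj_of_abs_sub_le_one (h : |j - i| ≤ 1) : A.Adj (e i) (e j) :=
  (e.adj_iff i _).2 ⟨j, h, rfl⟩

theorem isConnectedSet_image_ordConnected {s : Set ℤ} (hs : s.OrdConnected) :
    IsConnectedSet (e '' s) := by
  refine isConnectedSet_iff.2 fun T hT hno => ?_
  obtain ⟨-, ⟨i, hi, rfl⟩, hiT⟩ := hT
  have hstep {k l : ℤ} (hk : k ∈ s) (hl : l ∈ s) (hkl : |l - k| ≤ 1) (hkT : e k ∈ T) :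
      e l ∈ T :=
    by_contra fun hlT => hno _ ⟨⟨k, hk, rfl⟩, hkT⟩ _ ⟨⟨l, hl, rfl⟩, hlT⟩
      (adj_of_abs_sub_le_one hkl)
  rintro _ ⟨j, hj, rfl⟩
  rcases le_total i j with hij | hji
  · suffices ∀ k, i ≤ k → k ≤ j → e k ∈ T from this j hij le_rfl
    refine Int.leInduction (fun _ => hiT) fun k hik ih hkj => ?_
    exact hstep (hs.out hi hj ⟨hik, by omega⟩) (hs.out hi hj ⟨by omega, hkj⟩) (by simp)
      (ih (by omega))
  · suffices ∀ k, k ≤ i → j ≤ k → e k ∈ T from this j hji le_rfl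
    refine Int.leInductionDown (fun _ => hiT) fun k hki ih hjk => ?_
    exact hstep (hs.out hj hi ⟨by omega, hki⟩) (hs.out hj hi ⟨hjk, by omega⟩) (by simp)
      (ih (by omega))

end CyclicEnumeration

section Lifts

variable {A B C : FinGraph.{u}} {eA : CyclicEnumeration A} {eB : CyclicEnumeration B}
  {eC : CyclicEnumeration C} {f : A.V → B.V} {g : B.V → C.V} {F G : ℤ → ℤ}

/-- `F` lifts the map `f` between cycles along their enumerations by the integers. -/
structure IsLift (eA : CyclicEnumeration A) (eB : CyclicEnumeration B) (f : A.V → B.V)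
    (F : ℤ → ℤ) : Prop where
  map : ∀ k, f (eA k) = eB (F k)
  abs_step_le : ∀ k, |F (k + 1) - F k| ≤ 1

theorem exists_isLift (eA : CyclicEnumeration A) (eB : CyclicEnumeration B)
    (hf : ∀ a a', A.Adj a a' → B.Adj (f a) (f a')) : ∃ F, IsLift eA eB f F := by
  choose G hG using fun k => eB.surjective (f (eA k))
  have hnext (k : ℤ) : ∃ l, |l - G k| ≤ 1 ∧ eB l = f (eA (k + 1)) := by
    rw [← eB.adj_iff, hG]
    exact hf _ _ (CyclicEnumeration.adj_of_abs_sub_le_one (by simp))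
  choose N hN hmapN using hnext
  obtain ⟨F, hF0, hF⟩ := exists_antidifference (fun k => N k - G k) (G 0)
  have hiff (k : ℤ) : f (eA (k + 1)) = eB (F (k + 1)) ↔ f (eA k) = eB (F k) := by
    rw [hF, ← hmapN, ← hG k, ← CyclicEnumeration.apply_add_eq_iff (i := G k) (N k - G k),
      add_sub_cancel]
  refine ⟨F, fun k => ?_, fun k => by rw [hF, add_sub_cancel_left]; exact hN k⟩
  induction k with
  | zero => rw [hF0, hG]
  | succ k ih => exact (hiff k).2 ih
  | pred k ih => rw [← hiff, sub_add_cancel, ih]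

namespace IsLift

theorem sub_eq_sub_zero (hF : IsLift eA eB f F) (hG : IsLift eA eB f G) (k : ℤ) :
    G k - F k = G 0 - F 0 := by
  have hdvd (k : ℤ) : (eB.size : ℤ) ∣ G k - F k :=
    (eB.eq_iff _ _).1 ((hF.map k).symm.trans (hG.map k))
  have hstep (k : ℤ) : G (k + 1) - F (k + 1) = G k - F k := by
    refine sub_eq_zero.1 (Int.eq_zero_of_abs_lt_dvd (dvd_sub (hdvd (k + 1)) (hdvd k)) ?_)
    have hFk := hF.abs_step_le k
    have hGk := hG.abs_step_le k
    have := eB.three_le_size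
    rw [abs_le] at hFk hGk
    rw [abs_lt]
    omega
  induction k with
  | zero => rfl
  | succ k ih => rw [hstep, ih]
  | pred k ih => rw [← ih, ← hstep (-(k : ℤ) - 1), sub_add_cancel]

theorem abs_sub_le_one (h : IsLift eA eB f F) {i j : ℤ} (hij : |j - i| ≤ 1) :
    |F j - F i| ≤ 1 := by
  rw [abs_le] at hij
  obtain rfl | rfl | rfl : j = i ∨ j = i + 1 ∨ i = j + 1 := by omega
  · simp
  · exact h.abs_step_le i
  · exact abs_sub_comm (F j) _ ▸ h.abs_step_le j

theorem shift (h : IsLift eA eB f F) : IsLift eA eB f fun k => F (k + eA.size) where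
  map k := by rw [← h.map, ← eA.apply_add_mul_size 1, one_mul]
  abs_step_le k := by simpa [add_right_comm] using h.abs_step_le (k + eA.size)

theorem exists_degree (h : IsLift eA eB f F) :
    ∃ w : ℤ, ∀ k, F (k + eA.size) = F k + w * eB.size := by
  obtain ⟨w, hw⟩ := (eB.eq_iff _ _).1 ((h.map 0).symm.trans (h.shift.map 0))
  refine ⟨w, fun k => ?_⟩
  rw [mul_comm, ← hw, ← h.sub_eq_sub_zero h.shift k, add_sub_cancel]

theorem not_rise_and_fall (h : IsLift eA eB f F) (hf : IsConfluent f) {a b : ℤ} (hab : a < b)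
    (hrise : F (a + 1) = F a + 1) (hconst : ∀ i ∈ Set.Ioc a b, F i = F (a + 1)) :
    F (b + 1) ≠ F b - 1 := by
  intro hfall
  set J := F (a + 1) with hJ
  have hb : F b = J := hconst b ⟨hab, le_rfl⟩
  set Q : Set B.V := {eB J, eB (J + 1)}
  have hQ : IsConnectedSet Q :=
    isConnectedSet_pair (CyclicEnumeration.adj_of_abs_sub_le_one (by simp))
  have hnot : eB (J - 1) ∉ Q := by
    rintro (h | h) <;>
    · have := CyclicEnumeration.eq_of_abs_sub_le_two h (by rw [abs_le]; omega)
      omega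
  have ha : eA (a + 1) ∈ f ⁻¹' Q := Or.inl (h.map _)
  have hsub : component (f ⁻¹' Q) (eA (a + 1)) ⊆ eA '' Set.Ioc a b := by
    refine component_subset ⟨a + 1, ⟨by omega, by omega⟩, rfl⟩ ?_
    rintro _ ⟨-, i, hi, rfl⟩ y ⟨hyQ, hy⟩ hadj
    obtain ⟨l, hl, rfl⟩ := (eA.adj_iff i y).1 hadj
    have hlab : l ∉ Set.Ioc a b := fun hl => hy ⟨l, hl, rfl⟩
    have hFl : F l = J - 1 := by
      rw [abs_le] at hl
      rw [Set.mem_Ioc] at hi hlab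
      obtain rfl | rfl : l = a ∨ l = b + 1 := by omega
      all_goals omega
    rw [Set.mem_preimage, h.map, hFl] at hyQ
    exact hnot hyQ
  have hmem : eB (J + 1) ∈ f '' component (f ⁻¹' Q) (eA (a + 1)) := by
    rw [hf Q hQ _ ⟨_, ha, rfl⟩]
    exact Or.inr rfl
  obtain ⟨x, hx, hfx⟩ := hmem
  obtain ⟨i, hi, rfl⟩ := hsub hx
  rw [h.map, hconst i hi] at hfx
  have := CyclicEnumeration.eq_of_abs_sub_le_two hfx (by simp)
  omega

theorem monotone_of_rise (h : IsLift eA eB f F) (hf : IsConfluent f) {k : ℤ}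
    (hk : F (k + 1) = F k + 1) : Monotone F := by
  let Risen (l : ℤ) : Prop := ∃ a < l, F (a + 1) = F a + 1 ∧ ∀ i ∈ Set.Ioc a l, F i = F (a + 1)
  have hle {l : ℤ} (hl : Risen l) : F l ≤ F (l + 1) := by
    obtain ⟨a, hal, hrise, hconst⟩ := hl
    have := h.not_rise_and_fall hf hal hrise hconst
    have := abs_le.1 (h.abs_step_le l)
    omega
  have hsucc {l : ℤ} (hl : Risen l) : Risen (l + 1) := by
    rcases (hle hl).eq_or_lt with heq | hlt
    · obtain ⟨a, hal, hrise, hconst⟩ := hl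
      refine ⟨a, by omega, hrise, fun i hi => ?_⟩
      rcases hi.2.eq_or_lt with rfl | hil
      · rw [← heq, hconst l ⟨hal, le_rfl⟩]
      · exact hconst i ⟨hi.1, by omega⟩
    · have := abs_le.1 (h.abs_step_le l)
      refine ⟨l, by omega, by omega, fun i hi => ?_⟩
      rw [(show i = l + 1 from le_antisymm hi.2 hi.1)]
  have hrisen : ∀ l, k + 1 ≤ l → Risen l := by
    refine Int.leInduction ⟨k, by omega, hk, fun i hi => ?_⟩ fun l _ => hsucc
    rw [(show i = k + 1 from le_antisymm hi.2 hi.1)]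
  refine monotone_int_of_le_succ fun l => ?_
  obtain ⟨w, hw⟩ := h.exists_degree
  have hlarge : k + 1 ≤ l + |k + 1 - l| * eA.size := by
    have := eA.size_pos
    nlinarith [le_abs_self (k + 1 - l), abs_nonneg (k + 1 - l)]
  have := hle (hrisen _ hlarge)
  rwa [add_right_comm, map_add_int_mul hw, map_add_int_mul hw, add_le_add_iff_right] at this

theorem monotone_or_antitone (h : IsLift eA eB f F) (hf : IsConfluent f) :
    Monotone F ∨ Antitone F := by
  by_cases hrise : ∃ k, F (k + 1) = F k + 1
  · obtain ⟨k, hk⟩ := hrise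
    exact Or.inl (h.monotone_of_rise hf hk)
  · refine Or.inr (antitone_int_of_succ_le fun k => ?_)
    have hk : F (k + 1) ≠ F k + 1 := fun hk => hrise ⟨k, hk⟩
    have := abs_le.1 (h.abs_step_le k)
    omega

theorem comp_neg (h : IsLift eA eB f F) : IsLift eA.neg eB f fun k => F (-k) where
  map k := h.map (-k)
  abs_step_le k := by
    have := h.abs_step_le (-(k + 1))
    rwa [abs_sub_comm, neg_add, neg_add_cancel_right, ← neg_add] at this

theorem degree_pos (h : IsLift eA eB f F) (hmono : Monotone F) (hf : Function.Surjective f)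
    {w : ℤ} (hw : ∀ k, F (k + eA.size) = F k + w * eB.size) : 0 < w := by
  by_contra! hw0
  have hle (k l : ℤ) : F k ≤ F l := by
    have hkl : k ≤ l + |k - l| * eA.size := by
      nlinarith [le_abs_self (k - l), abs_nonneg (k - l), eA.size_pos]
    calc F k ≤ F (l + |k - l| * eA.size) := hmono hkl
      _ = F l + |k - l| * (w * eB.size) := by rw [map_add_int_mul hw, smul_eq_mul]
      _ ≤ F l := add_le_of_nonpos_right <| mul_nonpos_of_nonneg_of_nonpos (abs_nonneg _) <|
        mul_nonpos_of_nonpos_of_nonneg hw0 (Int.natCast_nonneg _)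
  obtain ⟨a, ha⟩ := hf (eB (F 0 + 1))
  obtain ⟨k, rfl⟩ := eA.surjective a
  rw [h.map, (hle k 0).antisymm (hle 0 k)] at ha
  have := CyclicEnumeration.eq_of_abs_sub_le_two ha (by simp)
  omega

end IsLift

/-- A monotone lift of a map between cycles, together with its degree. -/
structure MonotoneLift (eA : CyclicEnumeration A) (eB : CyclicEnumeration B) (f : A.V → B.V) where
  toFun : ℤ → ℤ
  degree : ℕ
  isLift : IsLift eA eB f toFun
  monotone : Monotone toFun
  degree_pos : 0 < degree
  map_add_size : ∀ k, toFun (k + eA.size) = toFun k + degree * eB.size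

theorem IsLift.nonempty_monotoneLift (h : IsLift eA eB f F) (hmono : Monotone F)
    (hf : Function.Surjective f) : Nonempty (MonotoneLift eA eB f) := by
  obtain ⟨w, hw⟩ := h.exists_degree
  have hpos := h.degree_pos hmono hf hw
  lift w to ℕ using hpos.le
  exact ⟨⟨F, w, h, hmono, by exact_mod_cast hpos, hw⟩⟩

theorem IsCycle.exists_monotoneLift (hA : IsCycle A) (eB : CyclicEnumeration B)
    (hf : IsEpimorphism f) (hconf : IsConfluent f) :
    ∃ eA : CyclicEnumeration A, Nonempty (MonotoneLift eA eB f) := by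
  obtain ⟨eA⟩ := hA.nonempty_cyclicEnumeration
  obtain ⟨F, h⟩ := exists_isLift eA eB hf.1
  rcases h.monotone_or_antitone hconf with hmono | hanti
  · exact ⟨eA, h.nonempty_monotoneLift hmono hf.2.1⟩
  · exact ⟨eA.neg, h.comp_neg.nonempty_monotoneLift (hanti.comp fun _ _ => neg_le_neg) hf.2.1⟩

namespace MonotoneLift

instance : CoeFun (MonotoneLift eA eB f) fun _ => ℤ → ℤ := ⟨toFun⟩

variable (L : MonotoneLift eA eB f)

theorem map_add_mul_size (k r : ℤ) : L (k + r * eA.size) = L k + r * (L.degree * eB.size) := by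
  rw [map_add_int_mul L.map_add_size, smul_eq_mul]

theorem map_succ_le (k : ℤ) : L (k + 1) ≤ L k + 1 := by
  have := abs_le.1 (L.isLift.abs_step_le k)
  omega

/-- Composition of monotone lifts; degrees multiply. -/
def comp (M : MonotoneLift eB eC g) (L : MonotoneLift eA eB f) : MonotoneLift eA eC (g ∘ f) where
  toFun := M ∘ L
  degree := L.degree * M.degree
  isLift :=
    { map := fun k => by simp only [Function.comp_apply, L.isLift.map, M.isLift.map]
      abs_step_le := fun k => M.isLift.abs_sub_le_one (L.isLift.abs_step_le k) }
  monotone := M.monotone.comp L.monotone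
  degree_pos := Nat.mul_pos L.degree_pos M.degree_pos
  map_add_size k := by
    simp only [Function.comp_apply, L.map_add_size, M.map_add_mul_size]
    push_cast
    ring

theorem exists_galoisConnection : ∃ s : ℤ → ℤ, GaloisConnection s L :=
  exists_galoisConnection_of_periodic L.monotone
    (mul_pos (by exact_mod_cast L.degree_pos) eB.size_pos) L.map_add_size

/-- The lower adjoint of a monotone lift, which takes `j` to the first integer over `j`. -/
noncomputable def lowerAdjoint : ℤ → ℤ := L.exists_galoisConnection.choose

theorem gc_lowerAdjoint : GaloisConnection L.lowerAdjoint L := L.exists_galoisConnection.choose_spec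

theorem map_lowerAdjoint_sub_one_lt (j : ℤ) : L (L.lowerAdjoint j - 1) < j := by
  by_contra! h
  have := L.gc_lowerAdjoint.l_le h
  omega

theorem map_lowerAdjoint (j : ℤ) : L (L.lowerAdjoint j) = j := by
  have hlt := L.map_lowerAdjoint_sub_one_lt j
  have := L.map_succ_le (L.lowerAdjoint j - 1)
  rw [sub_add_cancel] at this
  exact le_antisymm (by omega) (L.gc_lowerAdjoint.le_u_l j)

theorem lowerAdjoint_add_size (j : ℤ) :
    L.lowerAdjoint (j + L.degree * eB.size) = L.lowerAdjoint j + eA.size := by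
  refine eq_of_forall_ge_iff fun k => ?_
  have := L.map_add_size (k - eA.size)
  rw [sub_add_cancel] at this
  rw [L.gc_lowerAdjoint.le_iff_le, ← le_sub_iff_add_le (a := L.lowerAdjoint j),
    L.gc_lowerAdjoint.le_iff_le]
  omega

theorem lowerAdjoint_map_le (k : ℤ) : L.lowerAdjoint (L k) ≤ k :=
  L.gc_lowerAdjoint.l_u_le k

theorem succ_le_lowerAdjoint (k : ℤ) : k + 1 ≤ L.lowerAdjoint (L k + 1) := by
  by_contra! h
  have := L.gc_lowerAdjoint.le_u (Int.lt_add_one_iff.1 h)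
  omega

theorem surjective : Function.Surjective L :=
  fun j => ⟨L.lowerAdjoint j, L.map_lowerAdjoint j⟩

theorem component_fibre (k : ℤ) :
    component (f ⁻¹' {eB (L k)}) (eA k) = eA '' (L ⁻¹' {L k}) := by
  refine Set.Subset.antisymm (component_subset ⟨k, rfl, rfl⟩ ?_) (subset_component ⟨k, rfl, rfl⟩ ?_
    (CyclicEnumeration.isConnectedSet_image_ordConnected
      (Set.ordConnected_singleton.preimage_mono L.monotone)))
  · rintro _ ⟨-, i, hi, rfl⟩ y ⟨hyf, hy⟩ hadj
    obtain ⟨l, hl, rfl⟩ := (eA.adj_iff i y).1 hadj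
    rw [Set.mem_preimage, L.isLift.map, Set.mem_singleton_iff] at hyf
    refine hy ⟨l, CyclicEnumeration.eq_of_abs_sub_le_two hyf ?_, rfl⟩
    rw [← show L i = L k from hi, abs_sub_comm]
    exact (L.isLift.abs_sub_le_one hl).trans one_le_two
  · rintro _ ⟨l, hl, rfl⟩
    rw [Set.mem_preimage, L.isLift.map, show L l = L k from hl]
    rfl

theorem isComponent_fibre_iff (j : ℤ) (K : Set A.V) : IsComponent (f ⁻¹' {eB j}) K ↔
    ∃ t ∈ Set.Ico (0 : ℤ) L.degree, eA '' (L ⁻¹' {j + t * eB.size}) = K := by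
  have hdeg : (0 : ℤ) < L.degree := by exact_mod_cast L.degree_pos
  constructor
  · rintro ⟨a, ha, rfl⟩
    obtain ⟨k, rfl⟩ := eA.surjective a
    rw [Set.mem_preimage, L.isLift.map, Set.mem_singleton_iff] at ha
    obtain ⟨t, ht⟩ := (eB.eq_iff _ _).1 ha.symm
    set l := k + -(t / L.degree) * eA.size
    have hl : L l = j + t % L.degree * eB.size := by
      rw [L.map_add_mul_size, Int.emod_def]
      linear_combination ht
    refine ⟨t % L.degree, ⟨Int.emod_nonneg _ hdeg.ne', Int.emod_lt_of_pos _ hdeg⟩, ?_⟩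
    rw [← hl, ← L.component_fibre, hl, eB.apply_add_mul_size, eA.apply_add_mul_size]
  · rintro ⟨t, -, rfl⟩
    obtain ⟨k, hk⟩ := L.surjective (j + t * eB.size)
    have hkj : eB (L k) = eB j := by rw [hk, eB.apply_add_mul_size]
    exact ⟨eA k, (L.isLift.map k).trans hkj, by rw [← hk, ← L.component_fibre, hkj]⟩

theorem injOn_image_fibre (j : ℤ) :
    Set.InjOn (fun t : ℤ => eA '' (L ⁻¹' {j + t * eB.size})) (Set.Ico 0 L.degree) := by
  intro t ht t' ht' heq
  obtain ⟨k, hk⟩ := L.surjective (j + t * eB.size)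
  obtain ⟨l, hl, hlk⟩ : eA k ∈ eA '' (L ⁻¹' {j + t' * eB.size}) := heq.subset ⟨k, hk, rfl⟩
  obtain ⟨r, hr⟩ := (eA.eq_iff l k).1 hlk
  have hLk : L k = L l + r * (L.degree * eB.size) := by
    rw [← L.map_add_mul_size, mul_comm r, ← hr, add_sub_cancel]
  have hdvd : t - t' = L.degree * r := by
    rw [show L l = j + t' * eB.size from hl, hk] at hLk
    refine mul_right_cancel₀ eB.size_pos.ne' ?_
    linear_combination hLk
  have := Int.eq_zero_of_abs_lt_dvd ⟨r, hdvd⟩ (by rw [Set.mem_Ico] at ht ht'; rw [abs_lt]; omega)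
  omega

theorem hasWindingNumber : HasWindingNumber f L.degree := by
  intro b
  obtain ⟨j, rfl⟩ := eB.surjective b
  simp only [L.isComponent_fibre_iff]
  exact (L.injOn_image_fibre j).ncard_image.trans (by simp [Set.ncard_eq_toFinset_card'])

theorem degree_eq {n : ℕ} (h : HasWindingNumber f n) : L.degree = n :=
  (L.hasWindingNumber (eB 0)).symm.trans (h (eB 0))

/-- Any two consecutive steps of `L` together rise by at most one. This is the property of the lift
which corresponds to thick fibres of the map. -/
def IsThick (L : MonotoneLift eA eB f) : Prop :=
  ∀ k, L (k + 2) ≤ L k + 1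

theorem isThick (hf : HasThickFibres f) : L.IsThick := by
  intro k
  by_contra! hlt
  have h₁ := L.map_succ_le k
  have h₂ := L.map_succ_le (k + 1)
  rw [add_assoc, one_add_one_eq_two] at h₂
  have hsub : L ⁻¹' {L (k + 1)} ⊆ {k + 1} := by
    intro i hi
    have hi : L i = L (k + 1) := hi
    have hlo : k < i := L.monotone.reflect_lt (by omega)
    have hhi : i < k + 2 := L.monotone.reflect_lt (by omega)
    rw [Set.mem_singleton_iff]
    omega
  have hcard := hf (eB (L (k + 1))) _ ⟨eA (k + 1), L.isLift.map _, rfl⟩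
  rw [L.component_fibre] at hcard
  have hle : (eA '' (L ⁻¹' {L (k + 1)})).ncard ≤ ({eA (k + 1)} : Set A.V).ncard :=
    Set.ncard_le_ncard ((Set.image_mono hsub).trans Set.image_singleton.subset)
  rw [Set.ncard_singleton] at hle
  omega

theorem IsThick.lowerAdjoint_add_two_le {L : MonotoneLift eA eB f} (h : L.IsThick) (j : ℤ) :
    L.lowerAdjoint j + 2 ≤ L.lowerAdjoint (j + 1) := by
  by_contra! hlt
  have hfirst := L.map_lowerAdjoint_sub_one_lt j
  have hthick := h (L.lowerAdjoint j - 1)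
  rw [show L.lowerAdjoint j - 1 + 2 = L.lowerAdjoint j + 1 by ring] at hthick
  have := L.gc_lowerAdjoint.le_u (show L.lowerAdjoint (j + 1) ≤ L.lowerAdjoint j + 1 by omega)
  omega

end MonotoneLift
end Lifts

section Wrap

/-- The covering of the unit circle by the line which wraps each interval of length `c` around the
circle once. -/
noncomputable def wrap (c t : ℝ) : Circle :=
  Circle.exp (2 * Real.pi / c * t)

variable {c : ℝ}

theorem continuous_wrap (c : ℝ) : Continuous (wrap c) :=
  Circle.exp.continuous.comp (continuous_const_mul _)

theorem wrap_eq_wrap_iff (hc : c ≠ 0) {s t : ℝ} :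
    wrap c s = wrap c t ↔ ∃ r : ℤ, s = t + r * c := by
  rw [wrap, wrap, Circle.exp_eq_exp]
  refine exists_congr fun r => ?_
  have hpi := Real.pi_ne_zero
  field_simp

theorem wrap_surjective (hc : c ≠ 0) : Function.Surjective (wrap c) :=
  Circle.exp_surjective.comp (mul_left_surjective₀ (by positivity))

theorem wrap_natCast_mul_pow {n : ℕ} (hn : n ≠ 0) (c t : ℝ) : wrap (n * c) t ^ n = wrap c t := by
  rw [wrap, wrap, ← Circle.exp_natCast_mul]
  congr 1
  field_simp

theorem dist_wrap_le (hc : 0 < c) (s t : ℝ) :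
    dist (wrap c s) (wrap c t) ≤ 2 * Real.pi / c * |s - t| := by
  set a := 2 * Real.pi / c
  have hfactor : (wrap c s : ℂ) - wrap c t =
      wrap c t * (Complex.exp (Complex.I * ↑(a * (s - t))) - 1) := by
    simp only [wrap, Circle.coe_exp, mul_sub_one, ← Complex.exp_add, a]
    push_cast
    ring_nf
  calc dist (wrap c s) (wrap c t) = ‖Complex.exp (Complex.I * ↑(a * (s - t))) - 1‖ := by
        change dist (wrap c s : ℂ) (wrap c t) = _
        rw [Complex.dist_eq, hfactor, norm_mul, Circle.norm_coe, one_mul]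
    _ ≤ ‖a * (s - t)‖ := Real.norm_exp_I_mul_ofReal_sub_one_le
    _ = a * |s - t| := by rw [norm_mul, Real.norm_of_nonneg (by positivity), Real.norm_eq_abs]

end Wrap

section Subdivisions

variable {A B : FinGraph.{u}} {e eA : CyclicEnumeration A}
  {eB : CyclicEnumeration B} {f : A.V → B.V} {c c' : ℝ}

/-- A subdivision of the circle of circumference `c` into arcs indexed by the vertices of a cycle.
It is encoded by the endpoints of the arcs, lifted to the line. -/
structure Subdivision (e : CyclicEnumeration A) (c : ℝ) where
  toFun : ℤ → ℝ
  strictMono : StrictMono toFun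
  map_add_size : ∀ k, toFun (k + e.size) = toFun k + c

namespace Subdivision

instance : CoeFun (Subdivision e c) fun _ => ℤ → ℝ := ⟨toFun⟩

variable (P : Subdivision e c)

theorem map_add_mul_size (k r : ℤ) : P (k + r * e.size) = P k + r * c := by
  rw [map_add_int_mul P.map_add_size, zsmul_eq_mul]

include P in
theorem circumference_pos : 0 < c := by
  have := P.strictMono (lt_add_of_pos_right 0 e.size_pos)
  rwa [P.map_add_size, lt_add_iff_pos_right] at this

theorem gap_le (k : ℤ) : P (k + 1) - P k ≤ c := by
  have := P.strictMono.monotone (add_le_add_right e.size_pos k)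
  rw [P.map_add_size] at this
  exact sub_le_iff_le_add'.2 this

/-- The subdivision of the circle of circumference `1` into arcs of equal length. -/
noncomputable def uniform (e : CyclicEnumeration A) : Subdivision e 1 where
  toFun k := k / e.size
  strictMono k l hkl := by
    have hsize : (0 : ℝ) < e.size := by exact_mod_cast e.size_pos
    exact div_lt_div_of_pos_right (by exact_mod_cast hkl) hsize
  map_add_size k := by
    have : (e.size : ℝ) ≠ 0 := by exact_mod_cast e.size_pos.ne'
    push_cast
    field_simp

/-- The arc of the unit circle which belongs to the vertex `v`. -/
def arc (P : Subdivision e c) (v : A.V) : Set Circle :=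
  {z | ∃ k, e k = v ∧ ∃ t ∈ Set.Icc (P k) (P (k + 1)), wrap c t = z}

theorem mem_arc_apply_iff {k : ℤ} {z : Circle} :
    z ∈ P.arc (e k) ↔ ∃ t ∈ Set.Icc (P k) (P (k + 1)), wrap c t = z := by
  refine ⟨?_, fun h => ⟨k, rfl, h⟩⟩
  rintro ⟨l, hl, t, ht, rfl⟩
  obtain ⟨r, hr⟩ := (e.eq_iff l k).1 hl
  obtain rfl : k = l + r * e.size := by linear_combination hr
  rw [add_right_comm, P.map_add_mul_size, P.map_add_mul_size]
  exact ⟨t + r * c, ⟨by linarith [ht.1], by linarith [ht.2]⟩,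
    (wrap_eq_wrap_iff P.circumference_pos.ne').2 ⟨r, rfl⟩⟩

theorem wrap_mem_arc_iff {t : ℝ} {v : A.V} :
    wrap c t ∈ P.arc v ↔ ∃ k, e k = v ∧ t ∈ Set.Icc (P k) (P (k + 1)) := by
  refine ⟨?_, fun ⟨k, hk, ht⟩ => ⟨k, hk, t, ht, rfl⟩⟩
  rintro ⟨k, rfl, s, hs, hst⟩
  obtain ⟨r, rfl⟩ := (wrap_eq_wrap_iff P.circumference_pos.ne').1 hst.symm
  refine ⟨k + r * e.size, e.apply_add_mul_size r, ?_⟩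
  rw [add_right_comm, P.map_add_mul_size, P.map_add_mul_size]
  exact ⟨by linarith [hs.1], by linarith [hs.2]⟩

theorem isClosed_arc (v : A.V) : IsClosed (P.arc v) := by
  obtain ⟨k, rfl⟩ := e.surjective v
  have himage : P.arc (e k) = wrap c '' Set.Icc (P k) (P (k + 1)) :=
    Set.ext fun z => P.mem_arc_apply_iff
  exact himage ▸ (isCompact_Icc.image (continuous_wrap c)).isClosed

theorem arc_nonempty (v : A.V) : (P.arc v).Nonempty := by
  obtain ⟨k, rfl⟩ := e.surjective v
  exact ⟨_, k, rfl, P k, ⟨le_rfl, P.strictMono.monotone (by simp)⟩, rfl⟩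

theorem exists_mem_arc (z : Circle) : ∃ v, z ∈ P.arc v := by
  obtain ⟨s, rfl⟩ := wrap_surjective P.circumference_pos.ne' z
  obtain ⟨r, hr, -⟩ := existsUnique_add_zsmul_mem_Ico P.circumference_pos s (P 0)
  rw [zsmul_eq_mul, ← P.map_add_size] at hr
  obtain ⟨k, hk, hmax⟩ := Int.exists_greatest_of_bdd (P := fun k => P k ≤ s + r * c)
    ⟨_, fun k hk => (P.strictMono.lt_iff_lt.1 (hk.trans_lt hr.2)).le⟩ ⟨0, hr.1⟩
  have hlt : s + r * c < P (k + 1) := not_le.1 fun h => by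
    have := hmax _ h
    omega
  exact ⟨e k, k, rfl, _, ⟨hk, hlt.le⟩, (wrap_eq_wrap_iff P.circumference_pos.ne').2 ⟨r, rfl⟩⟩

theorem adj_of_mem_arc {v v' : A.V} {z : Circle} (hv : z ∈ P.arc v) (hv' : z ∈ P.arc v') :
    A.Adj v v' := by
  obtain ⟨k, rfl, t, ht, rfl⟩ := hv
  obtain ⟨l, rfl, hl⟩ := P.wrap_mem_arc_iff.1 hv'
  have h₁ := P.strictMono.le_iff_le.1 (ht.1.trans hl.2)
  have h₂ := P.strictMono.le_iff_le.1 (hl.1.trans ht.2)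
  exact CyclicEnumeration.adj_of_abs_sub_le_one (by rw [abs_le]; omega)

theorem exists_wrap_near_of_adj {ε : ℝ} (hε : ∀ k, P (k + 1) - P k ≤ ε) {v v' : A.V}
    (hadj : A.Adj v v') {z z' : Circle} (hz : z ∈ P.arc v) (hz' : z' ∈ P.arc v') :
    ∃ t t', wrap c t = z ∧ wrap c t' = z' ∧ |t - t'| ≤ 2 * ε := by
  obtain ⟨k, rfl, t, ht, rfl⟩ := hz
  obtain ⟨l, hl, rfl⟩ := (e.adj_iff k v').1 hadj
  obtain ⟨t', ht', rfl⟩ := P.mem_arc_apply_iff.1 hz'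
  refine ⟨t, t', rfl, rfl, ?_⟩
  have hk := hε k
  have hl' := hε l
  rw [abs_le] at hl
  have h₁ : P l ≤ P (k + 1) := P.strictMono.monotone (by omega)
  have h₂ : P k ≤ P (l + 1) := P.strictMono.monotone (by omega)
  rw [abs_le]
  constructor <;> linarith [ht.1, ht.2, ht'.1, ht'.2]

/-- `P'` refines `P` along the lift `L`: the arc of `P'` at `k` lies in the arc of `P` at `L k`, and
it is at most half as long. -/
structure Refines (P' : Subdivision eA c') (P : Subdivision eB c) (L : ℤ → ℤ) : Prop where
  left_le : ∀ k, P (L k) ≤ P' k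
  right_le : ∀ k, P' (k + 1) ≤ P (L k + 1)
  gap_le : ∀ k, P' (k + 1) - P' k ≤ (P (L k + 1) - P (L k)) / 2

theorem Refines.pow_mem_arc {n : ℕ} (hn : n ≠ 0) {P' : Subdivision eA (n * c)}
    {P : Subdivision eB c} {L : MonotoneLift eA eB f} (h : P'.Refines P L) {a : A.V} {z : Circle}
    (hz : z ∈ P'.arc a) : z ^ n ∈ P.arc (f a) := by
  obtain ⟨k, rfl, t, ht, rfl⟩ := hz
  rw [wrap_natCast_mul_pow hn]
  exact ⟨L k, (L.isLift.map k).symm, t,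
    ⟨(h.left_le k).trans ht.1, ht.2.trans (h.right_le k)⟩, rfl⟩

end Subdivision
end Subdivisions

section Refinement

variable {A B : FinGraph.{u}} {eA : CyclicEnumeration A} {eB : CyclicEnumeration B}
  {f : A.V → B.V} {c : ℝ} (P : Subdivision eB c) (L : MonotoneLift eA eB f)

namespace Subdivision

/-- The common length of the parts when the arc of `P` at `j` is cut into equal parts, one for each
integer which `L` maps to `j`. -/
noncomputable def partLength (j : ℤ) : ℝ :=
  (P (j + 1) - P j) / (L.lowerAdjoint (j + 1) - L.lowerAdjoint j)

/-- The left endpoint of the part with index `k` when each arc of `P` is cut into equal parts along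
`L`. -/
noncomputable def refinedPoint (k : ℤ) : ℝ :=
  P (L k) + (k - L.lowerAdjoint (L k)) * P.partLength L (L k)

variable {L}

theorem two_le_lowerAdjoint_sub (hL : L.IsThick) (j : ℤ) :
    (2 : ℝ) ≤ L.lowerAdjoint (j + 1) - L.lowerAdjoint j := by
  have : (L.lowerAdjoint j : ℝ) + 2 ≤ L.lowerAdjoint (j + 1) := by
    exact_mod_cast hL.lowerAdjoint_add_two_le j
  linarith

theorem partLength_pos (hL : L.IsThick) (j : ℤ) : 0 < P.partLength L j :=
  div_pos (sub_pos.2 (P.strictMono (lt_add_one j)))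
    (two_pos.trans_le (two_le_lowerAdjoint_sub hL j))

theorem partLength_le (hL : L.IsThick) (j : ℤ) :
    P.partLength L j ≤ (P (j + 1) - P j) / 2 :=
  div_le_div_of_nonneg_left (sub_nonneg.2 (P.strictMono.monotone (by simp))) two_pos
    (two_le_lowerAdjoint_sub hL j)

theorem mul_partLength (hL : L.IsThick) (j : ℤ) :
    (L.lowerAdjoint (j + 1) - L.lowerAdjoint j) * P.partLength L j = P (j + 1) - P j :=
  mul_div_cancel₀ _ (two_pos.trans_le (two_le_lowerAdjoint_sub hL j)).ne'

theorem refinedPoint_succ (hL : L.IsThick) (k : ℤ) :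
    P.refinedPoint L (k + 1) = P.refinedPoint L k + P.partLength L (L k) := by
  have hmono := L.monotone (lt_add_one k).le
  obtain hk | hk : L (k + 1) = L k ∨ L (k + 1) = L k + 1 := by
    have := L.map_succ_le k
    omega
  · simp only [refinedPoint, hk]
    push_cast
    ring
  · have hfirst : L.lowerAdjoint (L k + 1) = k + 1 :=
      le_antisymm (L.gc_lowerAdjoint.l_le hk.ge) (L.succ_le_lowerAdjoint k)
    have hmul := P.mul_partLength hL (L k)
    simp only [refinedPoint, hk, hfirst] at hmul ⊢
    push_cast at hmul ⊢
    linarith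

theorem le_refinedPoint (hL : L.IsThick) (k : ℤ) : P (L k) ≤ P.refinedPoint L k := by
  have hk : (L.lowerAdjoint (L k) : ℝ) ≤ k := by exact_mod_cast L.lowerAdjoint_map_le k
  exact le_add_of_nonneg_right (mul_nonneg (sub_nonneg.2 hk) (P.partLength_pos hL _).le)

theorem refinedPoint_succ_le (hL : L.IsThick) (k : ℤ) :
    P.refinedPoint L (k + 1) ≤ P (L k + 1) := by
  have hk : (k : ℝ) + 1 ≤ L.lowerAdjoint (L k + 1) := by exact_mod_cast L.succ_le_lowerAdjoint k
  have hmul := mul_le_mul_of_nonneg_right hk (P.partLength_pos hL (L k)).le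
  rw [P.refinedPoint_succ hL, refinedPoint]
  linarith [P.mul_partLength hL (L k)]

variable (L) in
theorem refinedPoint_add_size (k : ℤ) :
    P.refinedPoint L (k + eA.size) = P.refinedPoint L k + L.degree * c := by
  have hP (j : ℤ) : P (j + L.degree * eB.size) = P j + L.degree * c := by
    exact_mod_cast P.map_add_mul_size j L.degree
  simp only [refinedPoint, partLength, L.map_add_size, L.lowerAdjoint_add_size, hP,
    add_right_comm _ ((L.degree : ℤ) * eB.size) 1]
  push_cast
  ring

theorem exists_refines (hL : L.IsThick) :
    ∃ P' : Subdivision eA (L.degree * c), P'.Refines P L := by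
  refine ⟨⟨P.refinedPoint L, strictMono_int_of_lt_succ fun k => ?_, P.refinedPoint_add_size L⟩,
    P.le_refinedPoint hL, P.refinedPoint_succ_le hL, fun k => ?_⟩
  · rw [P.refinedPoint_succ hL]
    exact lt_add_of_pos_right _ (P.partLength_pos hL _)
  · simp only [P.refinedPoint_succ hL, add_sub_cancel_left]
    exact P.partLength_le hL _

end Subdivision
end Refinement

namespace GraphClass.InverseSequence

variable {D : GraphClass.{u}} (S : D.InverseSequence)

/-- The composite bonding map from stage `m` to stage `n`. -/
def bond (n : ℕ) {m : ℕ} (h : n ≤ m) : (S.F m).V → (S.F n).V :=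
  Nat.leRec (motive := fun m _ => (S.F m).V → (S.F n).V) id (fun m _ r => r ∘ S.α m) h

theorem bond_self (n : ℕ) : S.bond n le_rfl = id :=
  Nat.leRec_self ..

theorem bond_succ {n m : ℕ} (h : n ≤ m) : S.bond n (h.trans m.le_succ) = S.bond n h ∘ S.α m :=
  Nat.leRec_succ ..

theorem bond_self_succ (n : ℕ) : S.bond n n.le_succ = S.α n := by
  rw [S.bond_succ le_rfl, bond_self, Function.id_comp]

theorem bond_comp {n m k : ℕ} (h : n ≤ m) (h' : m ≤ k) :
    S.bond n h ∘ S.bond m h' = S.bond n (h.trans h') := by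
  induction k, h' using Nat.le_induction with
  | base => rw [bond_self, Function.comp_id]
  | succ k h' ih => rw [S.bond_succ h', S.bond_succ (h.trans h'), ← ih, Function.comp_assoc]

theorem bond_bond {n m k : ℕ} (h : n ≤ m) (h' : m ≤ k) (v : (S.F k).V) :
    S.bond n h (S.bond m h' v) = S.bond n (h.trans h') v :=
  congrFun (S.bond_comp h h') v

theorem bond_thread (x : S.Thread) {n m : ℕ} (h : n ≤ m) : S.bond n h (x.1 m) = x.1 n := by
  induction m, h using Nat.le_induction with
  | base => rw [bond_self, id]
  | succ m h ih => rw [S.bond_succ h, Function.comp_apply, x.2, ih]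

theorem bond_mem (hD : D.IsProjectiveFraisse) {n m : ℕ} (h : n ≤ m) :
    S.bond n h ∈ D.epi (S.F m) (S.F n) := by
  induction m, h using Nat.le_induction with
  | base => exact S.bond_self n ▸ hD.id_mem _ (S.F_mem n)
  | succ m h ih =>
    rw [S.bond_succ h]
    exact hD.comp_mem _ (S.F_mem _) _ (S.F_mem _) _ (S.F_mem _) _ (S.α_mem m) _ ih

theorem isEpimorphism_α (n : ℕ) : IsEpimorphism (S.α n) :=
  D.isEpimorphism _ (S.F_mem _) _ (S.F_mem _) _ (S.α_mem n)

theorem bond_adj {n m : ℕ} (h : n ≤ m) {v v' : (S.F m).V} (hadj : (S.F m).Adj v v') :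
    (S.F n).Adj (S.bond n h v) (S.bond n h v') := by
  induction m, h using Nat.le_induction with
  | base => rwa [bond_self]
  | succ m h ih =>
    rw [S.bond_succ h]
    exact ih ((S.isEpimorphism_α m).1 _ _ hadj)

theorem bond_surjective {n m : ℕ} (h : n ≤ m) : Function.Surjective (S.bond n h) := by
  induction m, h using Nat.le_induction with
  | base => exact S.bond_self n ▸ Function.surjective_id
  | succ m h ih => exact S.bond_succ h ▸ ih.comp (S.isEpimorphism_α m).2.1

theorem continuous_coord (n : ℕ) : Continuous fun x : S.Thread => x.1 n :=
  (continuous_apply n).comp continuous_subtype_val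

theorem exists_thread_of_cofinal {σ : ℕ → ℕ} (hσ : StrictMono σ) (y : ∀ i, (S.F (σ i)).V)
    (hy : ∀ i, S.bond (σ i) (hσ.monotone i.le_succ) (y (i + 1)) = y i) :
    ∃ x : S.Thread, ∀ i, x.1 (σ i) = y i := by
  have hbond (i j : ℕ) (h : i ≤ j) : S.bond (σ i) (hσ.monotone h) (y j) = y i := by
    induction j, h using Nat.le_induction with
    | base => rw [bond_self, id]
    | succ j h ih => rw [← ih, ← hy j, bond_bond]
  refine ⟨⟨fun n => S.bond n hσ.le_apply (y n), fun n => ?_⟩, fun i => hbond i _ hσ.le_apply⟩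
  change _ = S.bond n _ (y n)
  rw [← S.bond_self_succ, bond_bond, ← hy n, bond_bond]

theorem exists_thread (n : ℕ) (v : (S.F n).V) : ∃ x : S.Thread, x.1 n = v := by
  have hσ : StrictMono (n + ·) := add_right_strictMono
  choose r hr using fun i => S.bond_surjective (hσ.monotone (Nat.le_succ i))
  obtain ⟨x, hx⟩ := S.exists_thread_of_cofinal hσ
    (fun i => i.rec v fun j => r j) fun i => hr i _
  exact ⟨x, hx 0⟩

theorem exists_stage_subset {U : Set (S.limit.V × S.limit.V)} (hU : IsOpen U)
    (hdiag : ∀ x, (x, x) ∈ U) : ∃ n, ∀ x y : S.Thread, x.1 n = y.1 n → (x, y) ∈ U := by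
  have : CompactSpace S.Thread := S.limit.compact
  let Z (n : ℕ) : Set (S.Thread × S.Thread) := {p | p.1.1 n = p.2.1 n} \ U
  have hclosed (n : ℕ) : IsClosed (Z n) := IsClosed.sdiff (isClosed_eq
    ((S.continuous_coord n).comp continuous_fst) ((S.continuous_coord n).comp continuous_snd)) hU
  by_contra! hcon
  obtain ⟨⟨x, y⟩, hxy⟩ : (⋂ n, Z n).Nonempty := by
    refine IsCompact.nonempty_iInter_of_sequence_nonempty_isCompact_isClosed Z ?_
      (fun n => ?_) (hclosed 0).isCompact hclosed
    · rintro n ⟨x, y⟩ ⟨hxy, hnot⟩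
      refine ⟨?_, hnot⟩
      rw [Set.mem_ofPred_eq] at hxy ⊢
      rw [← x.2, ← y.2, hxy]
    · obtain ⟨x, y, h, hnot⟩ := hcon n
      exact ⟨(x, y), h, hnot⟩
  rw [Set.mem_iInter] at hxy
  obtain rfl : x = y := Subtype.ext (funext fun n => (hxy n).1)
  exact (hxy 0).2 (hdiag x)

/-- The inverse sequence of the stages `σ i`. -/
def subsequence (hD : D.IsProjectiveFraisse) {σ : ℕ → ℕ} (hσ : StrictMono σ) :
    D.InverseSequence where
  F i := S.F (σ i)
  F_mem i := S.F_mem (σ i)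
  α i := S.bond (σ i) (hσ.monotone i.le_succ)
  α_mem _ := S.bond_mem hD _

theorem limit_isomorphic_subsequence (hD : D.IsProjectiveFraisse) {σ : ℕ → ℕ}
    (hσ : StrictMono σ) : S.limit.Isomorphic (S.subsequence hD hσ).limit := by
  have : CompactSpace S.limit.V := S.limit.compact
  have : T2Space (S.subsequence hD hσ).limit.V := (S.subsequence hD hσ).limit.t2
  have hbond (x : S.Thread) (n : ℕ) : x.1 n = S.bond n hσ.le_apply (x.1 (σ n)) :=
    (S.bond_thread x hσ.le_apply).symm
  let restrict (x : S.Thread) : (S.subsequence hD hσ).Thread :=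
    ⟨fun i => x.1 (σ i), fun i => S.bond_thread x _⟩
  have hcont : Continuous restrict :=
    Continuous.subtype_mk (continuous_pi fun i => S.continuous_coord (σ i)) _
  have hbij : Function.Bijective restrict := by
    refine ⟨fun x y hxy => Subtype.ext (funext fun n => ?_), fun y => ?_⟩
    · rw [hbond x, hbond y]
      exact congrArg _ (congrFun (congrArg Subtype.val hxy) n)
    · obtain ⟨x, hx⟩ := S.exists_thread_of_cofinal hσ y.1 y.2
      exact ⟨x, Subtype.ext (funext hx)⟩
  refine ⟨Continuous.homeoOfEquivCompactToT2 (f := Equiv.ofBijective restrict hbij) hcont,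
    fun x y => ⟨fun h i => h (σ i), fun h n => ?_⟩⟩
  rw [hbond x, hbond y]
  exact S.bond_adj _ (h n)

end GraphClass.InverseSequence

section Realizations

variable {Z : Type*} [TopologicalSpace Z]

namespace TopGraph

/-- `Z` is a realization of `K`: there is a continuous surjection of `K` onto `Z` whose fibres are
exactly the adjacency classes. This makes sense before transitivity of the edge relation is known,
and implies it. -/
def RealizesAs (K : TopGraph.{u}) (Z : Type*) [TopologicalSpace Z] : Prop :=
  ∃ Φ : K.V → Z, Continuous Φ ∧ Function.Surjective Φ ∧ ∀ x y, K.Adj x y ↔ Φ x = Φ y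

variable {K : TopGraph.{u}}

theorem RealizesAs.adj_trans (h : K.RealizesAs Z) (x y z : K.V) (hxy : K.Adj x y)
    (hyz : K.Adj y z) : K.Adj x z := by
  obtain ⟨Φ, -, -, hΦ⟩ := h
  rw [hΦ] at *
  exact hxy.trans hyz

theorem RealizesAs.nonempty_homeomorph [T2Space Z] (h : K.RealizesAs Z)
    (ht : ∀ a b c, K.Adj a b → K.Adj b c → K.Adj a c) : Nonempty (K.Realization ht ≃ₜ Z) := by
  obtain ⟨Φ, hcont, hsurj, hΦ⟩ := h
  have := K.compact
  let Ψ : K.Realization ht → Z := Quotient.lift Φ fun x y => (hΦ x y).1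
  have hbij : Function.Bijective Ψ := by
    refine ⟨?_, fun z => ?_⟩
    · rintro ⟨x⟩ ⟨y⟩ hxy
      exact Quotient.sound ((hΦ x y).2 hxy)
    · obtain ⟨x, rfl⟩ := hsurj z
      exact ⟨Quotient.mk _ x, rfl⟩
  have hΨ : Continuous Ψ := hcont.quotient_lift _
  exact ⟨Continuous.homeoOfEquivCompactToT2 (f := Equiv.ofBijective Ψ hbij) hΨ⟩

theorem RealizesAs.of_isomorphic {L : TopGraph.{v}} (h : L.RealizesAs Z) (hKL : K.Isomorphic L) :
    K.RealizesAs Z := by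
  obtain ⟨Φ, hcont, hsurj, hΦ⟩ := h
  obtain ⟨e, he⟩ := hKL
  exact ⟨Φ ∘ e, hcont.comp e.continuous, hsurj.comp e.surjective,
    fun x y => (he x y).trans (hΦ _ _)⟩

theorem realizesAs_of_isClosed [CompactSpace Z] {R : K.V → Z → Prop}
    (hclosed : IsClosed {p : K.V × Z | R p.1 p.2}) (hleft : ∀ x, ∃ z, R x z)
    (hright : ∀ z, ∃ x, R x z) (hadj : ∀ x y z z', R x z → R y z' → (K.Adj x y ↔ z = z')) :
    K.RealizesAs Z := by
  choose Φ hΦ using hleft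
  have hgraph {x z} (h : R x z) : Φ x = z := (hadj x x _ _ (hΦ x) h).1 (K.refl x)
  refine ⟨Φ, continuous_iff_isClosed.2 fun C hC => ?_, fun z => (hright z).imp fun x => hgraph,
    fun x y => hadj x y _ _ (hΦ x) (hΦ y)⟩
  have hpre : Φ ⁻¹' C = Prod.fst '' ({p : K.V × Z | R p.1 p.2} ∩ Prod.snd ⁻¹' C) := by
    ext x
    constructor
    · exact fun hx => ⟨(x, Φ x), ⟨hΦ x, hx⟩, rfl⟩
    · rintro ⟨⟨x, z⟩, ⟨hR, hz⟩, rfl⟩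
      rwa [Set.mem_preimage, hgraph hR]
  exact hpre ▸ isClosedMap_fst_of_compactSpace _ (hclosed.inter (hC.preimage continuous_snd))

end TopGraph
end Realizations

section Solenoids

variable {w : ℕ → ℕ}

/-- The circumference of the circle at stage `i` in a solenoid with exponents `w`, chosen such that
the `w i`-th power map from stage `i + 1` to stage `i` becomes locally isometric. -/
def circumference (w : ℕ → ℕ) : ℕ → ℝ
  | 0 => 1
  | i + 1 => w i * circumference w i

theorem circumference_pos (hw : ∀ i, 0 < w i) (i : ℕ) : 0 < circumference w i := by
  induction i with
  | zero => exact one_pos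
  | succ i ih => exact mul_pos (Nat.cast_pos.2 (hw i)) ih

namespace SolenoidSpace

instance instCompactSpace : CompactSpace (SolenoidSpace w) := by
  have hclosed : IsClosed {z : ℕ → Circle | ∀ i, z (i + 1) ^ w i = z i} := by
    simp only [Set.ofPred_forall]
    exact isClosed_iInter fun i =>
      isClosed_eq ((continuous_apply (i + 1)).pow (w i)) (continuous_apply i)
  exact isCompact_iff_compactSpace.1 hclosed.isCompact

theorem continuous_coord (i : ℕ) : Continuous fun z : SolenoidSpace w => z.1 i :=
  (continuous_apply i).comp continuous_subtype_val

/-- The covering of the path component of the identity of a solenoid by the line. -/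
noncomputable def ofReal (hw : ∀ i, 0 < w i) (t : ℝ) : SolenoidSpace w :=
  ⟨fun i => wrap (circumference w i) t, fun i => wrap_natCast_mul_pow (hw i).ne' _ t⟩

theorem exists_apply_eq (hw : ∀ i, 0 < w i) (i : ℕ) (ζ : Circle) :
    ∃ z : SolenoidSpace w, z.1 i = ζ :=
  (wrap_surjective (circumference_pos hw i).ne' ζ).imp' (ofReal hw) fun _ => id

theorem apply_eq_wrap (hw : ∀ i, 0 < w i) (z : SolenoidSpace w) {i j : ℕ} (hij : i ≤ j) {t : ℝ}
    (h : wrap (circumference w j) t = z.1 j) : wrap (circumference w i) t = z.1 i := by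
  induction j, hij using Nat.le_induction with
  | base => exact h
  | succ j _ ih =>
    refine ih ?_
    rw [← z.2, ← h]
    exact (wrap_natCast_mul_pow (hw j).ne' _ t).symm

end SolenoidSpace
end Solenoids

section Towers

open GraphClass

variable {D : GraphClass.{u}} {S : D.InverseSequence}

/-- Enumerations of the stages of an inverse sequence of cycles with monotone lifts of its bonding
maps, together with subdivisions of the circles of a solenoid into arcs indexed by the vertices of
the stages, where each subdivision refines the preceding one. -/
structure SubdivisionTower (S : D.InverseSequence) where
  enum : ∀ i, CyclicEnumeration (S.F i)
  lift : ∀ i, MonotoneLift (enum (i + 1)) (enum i) (S.α i)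
  subdivision : ∀ i, Subdivision (enum i) (circumference (fun i => (lift i).degree) i)
  refines : ∀ i, (subdivision (i + 1)).Refines (subdivision i) (lift i)

theorem nonempty_subdivisionTower {e : ∀ i, CyclicEnumeration (S.F i)}
    (L : ∀ i, MonotoneLift (e (i + 1)) (e i) (S.α i)) (hL : ∀ i, (L i).IsThick) :
    Nonempty (SubdivisionTower S) := by
  choose next hrefines using fun i (P : Subdivision (e i)
    (circumference (fun i => (L i).degree) i)) => P.exists_refines (hL i)
  exact ⟨⟨e, L, fun i => i.rec (Subdivision.uniform (e 0)) next, fun i => hrefines i _⟩⟩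

namespace SubdivisionTower

variable (T : SubdivisionTower S)

/-- The exponents of the solenoid of a tower. -/
def degree (i : ℕ) : ℕ := (T.lift i).degree

theorem degree_pos (i : ℕ) : 0 < T.degree i := (T.lift i).degree_pos

theorem gap_le (i : ℕ) (k : ℤ) :
    T.subdivision i (k + 1) - T.subdivision i k ≤ (1 / 2) ^ i := by
  induction i generalizing k with
  | zero => exact (T.subdivision 0).gap_le k
  | succ i ih =>
    refine ((T.refines i).gap_le k).trans ?_
    rw [pow_succ]
    linarith [ih (T.lift i k)]

/-- A thread and a point of the solenoid are incident if each coordinate of the point lies in the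
arc of the corresponding coordinate of the thread. -/
def Incident (x : S.Thread) (z : SolenoidSpace T.degree) : Prop :=
  ∀ i, z.1 i ∈ (T.subdivision i).arc (x.1 i)

variable {T} in
theorem mem_arc_of_succ {i : ℕ} {x : S.Thread} {z : SolenoidSpace T.degree}
    (h : z.1 (i + 1) ∈ (T.subdivision (i + 1)).arc (x.1 (i + 1))) :
    z.1 i ∈ (T.subdivision i).arc (x.1 i) := by
  rw [← z.2, ← x.2]
  exact (T.refines i).pow_mem_arc (T.degree_pos i).ne' h

theorem isClosed_incident_coord (i : ℕ) : IsClosed {p : S.Thread × SolenoidSpace T.degree |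
    p.2.1 i ∈ (T.subdivision i).arc (p.1.1 i)} := by
  have harcs : IsClosed {q : (S.F i).V × Circle | q.2 ∈ (T.subdivision i).arc q.1} := by
    have hunion : {q : (S.F i).V × Circle | q.2 ∈ (T.subdivision i).arc q.1} =
        ⋃ v, {v} ×ˢ (T.subdivision i).arc v := by
      ext ⟨v, z⟩
      simp
    rw [hunion]
    exact isClosed_iUnion_of_finite fun v =>
      isClosed_singleton.prod ((T.subdivision i).isClosed_arc v)
  exact harcs.preimage (((S.continuous_coord i).comp continuous_fst).prodMk
    ((SolenoidSpace.continuous_coord i).comp continuous_snd))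

theorem isClosed_incident :
    IsClosed {p : S.Thread × SolenoidSpace T.degree | T.Incident p.1 p.2} := by
  simp only [Incident, Set.ofPred_forall]
  exact isClosed_iInter T.isClosed_incident_coord

theorem exists_incident_point (x : S.Thread) : ∃ z, T.Incident x z := by
  have hclosed (i : ℕ) :
      IsClosed {z : SolenoidSpace T.degree | z.1 i ∈ (T.subdivision i).arc (x.1 i)} :=
    (T.isClosed_incident_coord i).preimage (Continuous.prodMk_right x)
  have hne (i : ℕ) :
      {z : SolenoidSpace T.degree | z.1 i ∈ (T.subdivision i).arc (x.1 i)}.Nonempty := by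
    obtain ⟨ζ, hζ⟩ := (T.subdivision i).arc_nonempty (x.1 i)
    obtain ⟨z, rfl⟩ := SolenoidSpace.exists_apply_eq T.degree_pos i ζ
    exact ⟨z, hζ⟩
  obtain ⟨z, hz⟩ := IsCompact.nonempty_iInter_of_sequence_nonempty_isCompact_isClosed _
    (fun _ _ => mem_arc_of_succ) hne (hclosed 0).isCompact hclosed
  exact ⟨z, Set.mem_iInter.1 hz⟩

theorem exists_incident_thread (z : SolenoidSpace T.degree) : ∃ x, T.Incident x z := by
  have : CompactSpace S.Thread := S.limit.compact
  have hclosed (i : ℕ) : IsClosed {x : S.Thread | z.1 i ∈ (T.subdivision i).arc (x.1 i)} :=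
    (T.isClosed_incident_coord i).preimage (Continuous.prodMk_left z)
  have hne (i : ℕ) : {x : S.Thread | z.1 i ∈ (T.subdivision i).arc (x.1 i)}.Nonempty := by
    obtain ⟨v, hv⟩ := (T.subdivision i).exists_mem_arc (z.1 i)
    obtain ⟨x, rfl⟩ := S.exists_thread i v
    exact ⟨x, hv⟩
  obtain ⟨x, hx⟩ := IsCompact.nonempty_iInter_of_sequence_nonempty_isCompact_isClosed _
    (fun _ _ => mem_arc_of_succ) hne (hclosed 0).isCompact hclosed
  exact ⟨x, Set.mem_iInter.1 hx⟩

variable {T} {x y : S.Thread} {z z' : SolenoidSpace T.degree}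

theorem Incident.dist_apply_le (hx : T.Incident x z) (hy : T.Incident y z')
    (hadj : S.limit.Adj x y) {i j : ℕ} (hij : i ≤ j) : dist (z.1 i) (z'.1 i) ≤
      2 * Real.pi / circumference T.degree i * (2 * (1 / 2) ^ j) := by
  obtain ⟨t, t', ht, ht', hnear⟩ :=
    Subdivision.exists_wrap_near_of_adj _ (T.gap_le j) (hadj j) (hx j) (hy j)
  have hpos := circumference_pos T.degree_pos i
  rw [← SolenoidSpace.apply_eq_wrap T.degree_pos z hij ht,
    ← SolenoidSpace.apply_eq_wrap T.degree_pos z' hij ht']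
  exact (dist_wrap_le hpos t t').trans (mul_le_mul_of_nonneg_left hnear (by positivity))

theorem Incident.eq_of_adj (hx : T.Incident x z) (hy : T.Incident y z')
    (hadj : S.limit.Adj x y) : z = z' := by
  refine Subtype.ext (funext fun i => dist_le_zero.1 ?_)
  have hlim : Filter.Tendsto
      (fun j : ℕ => 2 * Real.pi / circumference T.degree i * (2 * (1 / 2 : ℝ) ^ j))
      Filter.atTop (nhds 0) := by
    have hpow := tendsto_pow_atTop_nhds_zero_of_lt_one (r := (1 / 2 : ℝ)) (by norm_num)
      (by norm_num)
    simpa only [mul_zero] using (hpow.const_mul 2).const_mul _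
  exact ge_of_tendsto hlim
    (Filter.eventually_atTop.2 ⟨i, fun j hij => hx.dist_apply_le hy hadj hij⟩)

theorem Incident.adj_iff (hx : T.Incident x z) (hy : T.Incident y z') :
    S.limit.Adj x y ↔ z = z' := by
  refine ⟨hx.eq_of_adj hy, ?_⟩
  rintro rfl i
  exact (T.subdivision i).adj_of_mem_arc (hx i) (hy i)

variable (T) in
theorem realizesAs : S.limit.RealizesAs (SolenoidSpace T.degree) :=
  TopGraph.realizesAs_of_isClosed T.isClosed_incident T.exists_incident_point
    T.exists_incident_thread fun _ _ _ _ => Incident.adj_iff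

end SubdivisionTower
end Towers

namespace GraphClass

variable {D : GraphClass.{u}}

namespace IsProjectiveFraisse

theorem isomorphic_trans (hD : D.IsProjectiveFraisse) {A B C : FinGraph.{u}} (hA : A ∈ D.obj)
    (hB : B ∈ D.obj) (hC : C ∈ D.obj) :
    D.Isomorphic A B → D.Isomorphic B C → D.Isomorphic A C := by
  rintro ⟨f, hf, g, hg, hgf, hfg⟩ ⟨f', hf', g', hg', hgf', hfg'⟩
  refine ⟨f' ∘ f, hD.comp_mem _ hA _ hB _ hC _ hf _ hf', g ∘ g',
    hD.comp_mem _ hC _ hB _ hA _ hg' _ hg, ?_, ?_⟩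
  · rw [Function.comp_assoc, ← Function.comp_assoc g', hgf', Function.id_comp, hgf]
  · rw [Function.comp_assoc, ← Function.comp_assoc f, hfg, Function.id_comp, hfg']

/-- Isomorphism in the class, as an equivalence relation on its members. -/
def isomorphicSetoid (hD : D.IsProjectiveFraisse) : Setoid D.obj where
  r A B := D.Isomorphic A B
  iseqv :=
    { refl := fun A => ⟨id, hD.id_mem _ A.2, id, hD.id_mem _ A.2, rfl, rfl⟩
      symm := fun ⟨f, hf, g, hg, hgf, hfg⟩ => ⟨g, hg, f, hf, hfg, hgf⟩
      trans := fun {A B C} => hD.isomorphic_trans A.2 B.2 C.2 }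

theorem exists_countable_representatives (hD : D.IsProjectiveFraisse) :
    ∃ R : Set D.obj, R.Countable ∧ ∀ A : D.obj, ∃ A' ∈ R, D.Isomorphic A A' := by
  let s := hD.isomorphicSetoid
  let out (q : Quotient s) : D.obj := q.out
  refine ⟨Set.range out, ?_, fun A => ⟨_, ⟨Quotient.mk s A, rfl⟩, s.symm (Quotient.mk_out A)⟩⟩
  refine Set.countable_of_injective_of_countable_image Subtype.val_injective.injOn
    (hD.countable _ ?_ ?_)
  · rintro _ ⟨A, -, rfl⟩
    exact A.2
  · rintro _ ⟨_, ⟨q, rfl⟩, rfl⟩ _ ⟨_, ⟨q', rfl⟩, rfl⟩ hne hiso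
    refine hne (congrArg (fun q => (out q : FinGraph)) ?_)
    rw [← q.out_eq, ← q'.out_eq]
    exact Quotient.sound hiso

end IsProjectiveFraisse

/-- The epimorphisms of the class, bundled with their source and target. -/
abbrev Epi (D : GraphClass.{u}) : Type (u + 1) :=
  Σ p : D.obj × D.obj, D.epi p.1 p.2

/-- `α` absorbs the epimorphism `g` if the source of `α` maps onto the target of `g`, and every map
from the target of `α` to the target of `g` lifts along `g` after composition with `α`. -/
def Absorbs (D : GraphClass.{u}) {E F A B : FinGraph.{u}} (α : E.V → F.V) (g : B.V → A.V) : Prop :=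
  (D.epi E A).Nonempty ∧ ∀ φ ∈ D.epi F A, ∃ ψ ∈ D.epi E B, φ ∘ α = g ∘ ψ

namespace IsProjectiveFraisse

variable {E F A B A' B' : FinGraph.{u}}

theorem exists_lifting_extension (hD : D.IsProjectiveFraisse) (hF : F ∈ D.obj) (hA : A ∈ D.obj)
    (hB : B ∈ D.obj) {g : B.V → A.V} (hg : g ∈ D.epi B A) :
    ∃ E ∈ D.obj, ∃ α ∈ D.epi E F, ∀ φ ∈ D.epi F A, ∃ ψ ∈ D.epi E B, φ ∘ α = g ∘ ψ := by
  refine (D.epi F A).toFinite.induction_on_subset _ ⟨F, hF, id, hD.id_mem _ hF, by simp⟩ ?_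
  rintro φ T hφ - - ⟨E, hE, α, hα, h⟩
  obtain ⟨E', hE', β, hβ, γ, hγ, hcomm⟩ := hD.amalgamation A hA E hE B hB (φ ∘ α)
    (hD.comp_mem _ hE _ hF _ hA _ hα _ hφ) g hg
  refine ⟨E', hE', α ∘ β, hD.comp_mem _ hE' _ hE _ hF _ hβ _ hα, ?_⟩
  rintro φ' (rfl | hφ')
  · exact ⟨γ, hγ, hcomm⟩
  · obtain ⟨ψ, hψ, hlift⟩ := h φ' hφ'
    refine ⟨ψ ∘ β, hD.comp_mem _ hE' _ hE _ hB _ hβ _ hψ, ?_⟩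
    rw [← Function.comp_assoc, hlift, Function.comp_assoc]

theorem exists_absorbing (hD : D.IsProjectiveFraisse) (hF : F ∈ D.obj) (hA : A ∈ D.obj)
    (hB : B ∈ D.obj) {g : B.V → A.V} (hg : g ∈ D.epi B A) :
    ∃ E ∈ D.obj, ∃ α ∈ D.epi E F, D.Absorbs α g := by
  obtain ⟨E, hE, α, hα, h⟩ := hD.exists_lifting_extension hF hA hB hg
  obtain ⟨E', hE', ⟨β, hβ⟩, hne⟩ := hD.joint E hE A hA
  refine ⟨E', hE', α ∘ β, hD.comp_mem _ hE' _ hE _ hF _ hβ _ hα, hne, fun φ hφ => ?_⟩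
  obtain ⟨ψ, hψ, hlift⟩ := h φ hφ
  refine ⟨ψ ∘ β, hD.comp_mem _ hE' _ hE _ hB _ hβ _ hψ, ?_⟩
  rw [← Function.comp_assoc, hlift, Function.comp_assoc]

theorem absorbs_of_isomorphic (hD : D.IsProjectiveFraisse) (hA : A ∈ D.obj) (hB : B ∈ D.obj)
    (hA' : A' ∈ D.obj) (hB' : B' ∈ D.obj) {i : A.V → A'.V} (hi : i ∈ D.epi A A') {j : A'.V → A.V}
    (hj : j ∈ D.epi A' A) (hji : j ∘ i = id) {k : B'.V → B.V} (hk : k ∈ D.epi B' B)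
    {g : B.V → A.V} (hE : E ∈ D.obj) (hF : F ∈ D.obj) {α : E.V → F.V}
    (h : D.Absorbs α (i ∘ g ∘ k)) : D.Absorbs α g := by
  obtain ⟨⟨χ, hχ⟩, hlift⟩ := h
  refine ⟨⟨j ∘ χ, hD.comp_mem _ hE _ hA' _ hA _ hχ _ hj⟩, fun φ hφ => ?_⟩
  obtain ⟨ψ, hψ, hcomm⟩ := hlift (i ∘ φ) (hD.comp_mem _ hF _ hA _ hA' _ hφ _ hi)
  refine ⟨k ∘ ψ, hD.comp_mem _ hE _ hB' _ hB _ hψ _ hk, ?_⟩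
  have := congrArg (j ∘ ·) hcomm
  simpa only [← Function.comp_assoc, hji, Function.id_comp] using this

theorem exists_dominating_sequence (hD : D.IsProjectiveFraisse) (hne : D.obj.Nonempty) :
    ∃ τ : ℕ → D.Epi, ∀ g : D.Epi, ∃ k, ∀ {E F : FinGraph.{u}}, E ∈ D.obj → F ∈ D.obj →
      ∀ α : E.V → F.V, D.Absorbs α (τ k).2.1 → D.Absorbs α g.2.1 := by
  obtain ⟨R, hR, hrep⟩ := hD.exists_countable_representatives
  have : Countable R := hR.to_subtype
  let T := Σ p : R × R, D.epi p.1.1 p.2.1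
  have : Nonempty T := by
    obtain ⟨A, hA⟩ := hne
    obtain ⟨A', hA', -⟩ := hrep ⟨A, hA⟩
    exact ⟨⟨(⟨A', hA'⟩, ⟨A', hA'⟩), id, hD.id_mem _ A'.2⟩⟩
  obtain ⟨τ, hτ⟩ := exists_surjective_nat T
  let incl (t : T) : D.Epi := ⟨(t.1.1.1, t.1.2.1), t.2⟩
  have hincl : ∀ g : D.Epi, ∃ t, ∀ {E F : FinGraph.{u}}, E ∈ D.obj → F ∈ D.obj →
      ∀ α : E.V → F.V, D.Absorbs α (incl t).2.1 → D.Absorbs α g.2.1 := by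
    rintro ⟨⟨B, A⟩, g, hg⟩
    obtain ⟨A', hA', i, hi, j, hj, hji, -⟩ := hrep A
    obtain ⟨B', hB', -, -, l, hl, -⟩ := hrep B
    exact ⟨⟨(⟨B', hB'⟩, ⟨A', hA'⟩), i ∘ g ∘ l, hD.comp_mem _ B'.2 _ A.2 _ A'.2 _
      (hD.comp_mem _ B'.2 _ B.2 _ A.2 _ hl _ hg) _ hi⟩, fun hE hF _ h =>
        hD.absorbs_of_isomorphic A.2 B.2 A'.2 B'.2 hi hj hji hl hE hF h⟩
  refine ⟨incl ∘ τ, fun g => ?_⟩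
  obtain ⟨t, ht⟩ := hincl g
  obtain ⟨k, rfl⟩ := hτ t
  exact ⟨k, ht⟩

theorem exists_inverseSequence_absorbing (hD : D.IsProjectiveFraisse) (hne : D.obj.Nonempty)
    (τ : ℕ → D.Epi) : ∃ S : D.InverseSequence, ∀ n, D.Absorbs (S.α n) (τ n).2.1 := by
  have hstep (F : D.obj) (g : D.Epi) :
      ∃ E : D.obj, ∃ α ∈ D.epi E.1 F.1, D.Absorbs α g.2.1 := by
    obtain ⟨E, hE, h⟩ := hD.exists_absorbing F.2 g.1.2.2 g.1.1.2 g.2.2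
    exact ⟨⟨E, hE⟩, h⟩
  choose next α hα habsorbs using hstep
  let F (n : ℕ) : D.obj := n.rec ⟨_, hne.some_mem⟩ fun n E => next E (τ n)
  exact ⟨⟨fun n => (F n).1, fun n => (F n).2, fun n => α (F n) (τ n), fun n => hα _ _⟩,
    fun n => habsorbs _ _⟩

theorem isLimiting_of_absorbs (hD : D.IsProjectiveFraisse) (S : D.InverseSequence)
    (hS : ∀ (g : D.Epi) (n : ℕ), ∃ m ≥ n, D.Absorbs (S.α m) g.2.1) : S.IsLimiting where
  onto A hA := by
    obtain ⟨m, -, ⟨φ, hφ⟩, -⟩ := hS ⟨(⟨A, hA⟩, ⟨A, hA⟩), id, hD.id_mem A hA⟩ 0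
    exact ⟨fun x => φ (x.1 (m + 1)), m + 1, φ, hφ, fun _ => rfl⟩
  lifting A hA B hB f := by
    rintro ⟨n, φ, hφ, hf⟩ g hg
    obtain ⟨m, hnm, -, hlift⟩ := hS ⟨(⟨B, hB⟩, ⟨A, hA⟩), g, hg⟩ n
    obtain ⟨ψ, hψ, hcomm⟩ := hlift (φ ∘ S.bond n hnm)
      (hD.comp_mem _ (S.F_mem _) _ (S.F_mem _) _ hA _ (S.bond_mem hD hnm) _ hφ)
    refine ⟨fun x => ψ (x.1 (m + 1)), ⟨m + 1, ψ, hψ, fun _ => rfl⟩,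
      funext fun (x : S.Thread) => ?_⟩
    calc f x = φ (S.bond n hnm (S.α m (x.1 (m + 1)))) := by rw [hf, x.2, S.bond_thread]
      _ = g (ψ (x.1 (m + 1))) := congrFun hcomm _
  refining U hU hdiag := by
    obtain ⟨n, hn⟩ := S.exists_stage_subset hU hdiag
    exact ⟨S.F n, S.F_mem n, fun x => x.1 n, ⟨n, id, hD.id_mem _ (S.F_mem n), fun _ => rfl⟩, hn⟩

theorem exists_isProjectiveFraisseLimit (hD : D.IsProjectiveFraisse) (hne : D.obj.Nonempty) :
    ∃ K : TopGraph.{u}, D.IsProjectiveFraisseLimit K := by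
  obtain ⟨τ, hτ⟩ := hD.exists_dominating_sequence hne
  -- Each `τ k` recurs at every stage of the form `Nat.pair k n`, hence infinitely often.
  obtain ⟨S, hS⟩ := hD.exists_inverseSequence_absorbing hne fun n => τ n.unpair.1
  refine ⟨S.limit, S, ⟨Homeomorph.refl _, fun _ _ => Iff.rfl⟩,
    hD.isLimiting_of_absorbs S fun g n => ?_⟩
  obtain ⟨k, hk⟩ := hτ g
  refine ⟨Nat.pair k n, Nat.right_le_pair k n, hk (S.F_mem _) (S.F_mem _) _ ?_⟩
  have := hS (Nat.pair k n)
  rwa [Nat.unpair_pair] at this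

end IsProjectiveFraisse

end GraphClass

theorem IsCycle.nonempty {A : FinGraph.{u}} (hA : IsCycle A) : Nonempty A.V :=
  hA.nonempty_cyclicEnumeration.map fun e => e 0

theorem HasWindingNumber.unique {A B : FinGraph.{u}} [Nonempty B.V] {f : A.V → B.V} {m n : ℕ}
    (hm : HasWindingNumber f m) (hn : HasWindingNumber f n) : m = n :=
  (hm (Classical.arbitrary _)).symm.trans (hn _)

namespace GraphClass

variable {D : GraphClass.{u}}

namespace IsClassOfCycles

variable {A B C : FinGraph.{u}} {f : A.V → B.V} {g : B.V → C.V}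

theorem exists_monotoneLift (hcyc : D.IsClassOfCycles) (hA : A ∈ D.obj) (hB : B ∈ D.obj)
    (hf : f ∈ D.epi A B) (eB : CyclicEnumeration B) : ∃ eA, Nonempty (MonotoneLift eA eB f) :=
  (hcyc.1 A hA).exists_monotoneLift eB (D.isEpimorphism A hA B hB f hf) (hcyc.2 A hA B hB f hf)

theorem exists_hasWindingNumber (hcyc : D.IsClassOfCycles) (hA : A ∈ D.obj) (hB : B ∈ D.obj)
    (hf : f ∈ D.epi A B) : ∃ n, 0 < n ∧ HasWindingNumber f n := by
  obtain ⟨eB⟩ := (hcyc.1 B hB).nonempty_cyclicEnumeration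
  obtain ⟨_, ⟨L⟩⟩ := hcyc.exists_monotoneLift hA hB hf eB
  exact ⟨L.degree, L.degree_pos, L.hasWindingNumber⟩

theorem hasWindingNumber_comp (hcyc : D.IsClassOfCycles) (hA : A ∈ D.obj) (hB : B ∈ D.obj)
    (hC : C ∈ D.obj) (hf : f ∈ D.epi A B) (hg : g ∈ D.epi B C) {m n : ℕ}
    (hm : HasWindingNumber f m) (hn : HasWindingNumber g n) : HasWindingNumber (g ∘ f) (m * n) := by
  obtain ⟨eC⟩ := (hcyc.1 C hC).nonempty_cyclicEnumeration
  obtain ⟨eB, ⟨M⟩⟩ := hcyc.exists_monotoneLift hB hC hg eC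
  obtain ⟨_, ⟨L⟩⟩ := hcyc.exists_monotoneLift hA hB hf eB
  rw [← L.degree_eq hm, ← M.degree_eq hn]
  exact (M.comp L).hasWindingNumber

end IsClassOfCycles

namespace InverseSequence

variable {S : D.InverseSequence}

theorem exists_realizesAs (hcyc : D.IsClassOfCycles) (hthick : ∀ i, HasThickFibres (S.α i)) :
    ∃ w, (∀ i, HasWindingNumber (S.α i) (w i)) ∧ S.limit.RealizesAs (SolenoidSpace w) := by
  obtain ⟨e₀⟩ := (hcyc.1 _ (S.F_mem 0)).nonempty_cyclicEnumeration
  choose next hnext using fun i =>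
    hcyc.exists_monotoneLift (S.F_mem (i + 1)) (S.F_mem i) (S.α_mem i)
  let e (i : ℕ) : CyclicEnumeration (S.F i) := i.rec e₀ next
  let L (i : ℕ) : MonotoneLift (e (i + 1)) (e i) (S.α i) := (hnext i (e i)).some
  obtain ⟨T⟩ := nonempty_subdivisionTower L fun i => (L i).isThick (hthick i)
  exact ⟨T.degree, fun i => (T.lift i).hasWindingNumber, T.realizesAs⟩

theorem exists_realizesAs_of_stages (hD : D.IsProjectiveFraisse) (hcyc : D.IsClassOfCycles)
    {c : ℕ} (hS : ∀ n, ∃ m, ∃ h : n < m, HasThickFibres (S.bond n h.le) ∧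
      ∃ w, c ≤ w ∧ HasWindingNumber (S.bond n h.le) w) :
    ∃ w, (∀ i, c ≤ w i) ∧ S.limit.RealizesAs (SolenoidSpace w) := by
  choose next hlt hthick w hcw hw using hS
  let σ (i : ℕ) : ℕ := i.rec 0 fun _ n => next n
  have hσ : StrictMono σ := strictMono_nat_of_lt_succ fun i => hlt (σ i)
  obtain ⟨w', hw', hreal⟩ :=
    exists_realizesAs (S := S.subsequence hD hσ) hcyc fun i => hthick (σ i)
  refine ⟨w', fun i => ?_, hreal.of_isomorphic (S.limit_isomorphic_subsequence hD hσ)⟩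
  have := (hcyc.1 _ (S.F_mem (σ i))).nonempty
  exact (hcw (σ i)).trans_eq ((hw (σ i)).unique (hw' i))

namespace IsLimiting

theorem exists_factorization (hS : S.IsLimiting) (hD : D.IsProjectiveFraisse) {A B : FinGraph.{u}}
    (hA : A ∈ D.obj) (hB : B ∈ D.obj) {n : ℕ} {φ : (S.F n).V → A.V} (hφ : φ ∈ D.epi (S.F n) A)
    {g : B.V → A.V} (hg : g ∈ D.epi B A) :
    ∃ m, ∃ h : n ≤ m, ∃ ψ ∈ D.epi (S.F m) B, φ ∘ S.bond n h = g ∘ ψ := by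
  obtain ⟨f, ⟨k, ψ, hψ, hf⟩, hcomm⟩ :=
    hS.lifting A hA B hB (fun x => φ (x.1 n)) ⟨n, φ, hφ, fun _ => rfl⟩ g hg
  refine ⟨max n k, le_max_left n k, ψ ∘ S.bond k (le_max_right n k),
    hD.comp_mem _ (S.F_mem _) _ (S.F_mem _) _ hB _ (S.bond_mem hD _) _ hψ, funext fun v => ?_⟩
  obtain ⟨x, rfl⟩ := S.exists_thread _ v
  simp only [Function.comp_apply, bond_thread]
  exact (congrFun hcomm x).trans (congrArg g (hf x))

variable (hS : S.IsLimiting) (hD : D.IsProjectiveFraisse) (hcyc : D.IsClassOfCycles)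
include hS hD hcyc

theorem exists_thick_stage (hthick : D.HasThickPreimages) (n : ℕ) :
    ∃ m, ∃ h : n < m, HasThickFibres (S.bond n h.le) := by
  obtain ⟨B, hB, f, hf, hfthick⟩ := hthick _ (S.F_mem n)
  obtain ⟨m, hnm, ψ, hψ, hcomm⟩ :=
    hS.exists_factorization hD (S.F_mem n) hB (hD.id_mem _ (S.F_mem n)) hf
  rw [Function.id_comp] at hcomm
  have hbond : HasThickFibres (S.bond n hnm) := by
    rw [hcomm]
    exact HasThickFibres.comp_confluent hfthick (hcyc.2 _ (S.F_mem m) B hB ψ hψ)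
  refine ⟨m + 1, Nat.lt_succ_of_le hnm, ?_⟩
  rw [S.bond_succ hnm]
  exact hbond.comp_confluent (hcyc.2 _ (S.F_mem _) _ (S.F_mem _) _ (S.α_mem m))

theorem exists_winding_stage {C : FinGraph.{u}} (hC : C ∈ D.obj)
    (hinf : (D.windingNumbersOnto C).Infinite) (n : ℕ) :
    ∃ m, ∃ h : n ≤ m, ∃ w, 2 ≤ w ∧ HasWindingNumber (S.bond n h) w := by
  obtain ⟨-, j, φ, hφ, -⟩ := hS.onto C hC
  set p := max n j
  have hnp : n ≤ p := le_max_left n j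
  have hjp : j ≤ p := le_max_right n j
  have hφp : φ ∘ S.bond j hjp ∈ D.epi (S.F p) C :=
    hD.comp_mem _ (S.F_mem p) _ (S.F_mem j) _ hC _ (S.bond_mem hD hjp) _ hφ
  obtain ⟨a, -, ha⟩ := hcyc.exists_hasWindingNumber (S.F_mem p) hC hφp
  obtain ⟨W, ⟨B, hB, g, hg, hW⟩, haW⟩ := hinf.exists_gt a
  obtain ⟨m, hpm, ψ, hψ, hcomm⟩ := hS.exists_factorization hD hC hB hφp hg
  obtain ⟨d, -, hd⟩ :=
    hcyc.exists_hasWindingNumber (S.F_mem m) (S.F_mem p) (S.bond_mem hD hpm)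
  obtain ⟨v, hv, hψv⟩ := hcyc.exists_hasWindingNumber (S.F_mem m) hB hψ
  obtain ⟨b, hb, hnb⟩ :=
    hcyc.exists_hasWindingNumber (S.F_mem p) (S.F_mem n) (S.bond_mem hD hnp)
  have hmul : d * a = v * W := by
    have := (hcyc.1 C hC).nonempty
    have hda := hcyc.hasWindingNumber_comp (S.F_mem m) (S.F_mem p) hC (S.bond_mem hD hpm) hφp hd ha
    rw [hcomm] at hda
    exact hda.unique (hcyc.hasWindingNumber_comp (S.F_mem m) hB hC hψ hg hψv hW)
  have hd₂ : 2 ≤ d := by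
    by_contra! hlt
    have hda : d * a ≤ 1 * a := Nat.mul_le_mul_right a (by omega)
    have hvW : 1 * W ≤ v * W := Nat.mul_le_mul_right W hv
    omega
  refine ⟨m, hnp.trans hpm, d * b, hd₂.trans (Nat.le_mul_of_pos_right d hb), ?_⟩
  rw [← S.bond_comp hnp hpm]
  exact hcyc.hasWindingNumber_comp (S.F_mem m) (S.F_mem p) (S.F_mem n) (S.bond_mem hD hpm)
    (S.bond_mem hD hnp) hd hnb

theorem exists_realizesAs_one_le (hthick : D.HasThickPreimages) :
    ∃ w, (∀ i, 1 ≤ w i) ∧ S.limit.RealizesAs (SolenoidSpace w) := by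
  refine exists_realizesAs_of_stages hD hcyc fun n => ?_
  obtain ⟨m, h, hbond⟩ := hS.exists_thick_stage hD hcyc hthick n
  exact ⟨m, h, hbond,
    hcyc.exists_hasWindingNumber (S.F_mem m) (S.F_mem n) (S.bond_mem hD h.le)⟩

theorem exists_realizesAs_two_le (hthick : D.HasThickPreimages) {C : FinGraph.{u}}
    (hC : C ∈ D.obj) (hinf : (D.windingNumbersOnto C).Infinite) :
    ∃ w, (∀ i, 2 ≤ w i) ∧ S.limit.RealizesAs (SolenoidSpace w) := by
  refine exists_realizesAs_of_stages hD hcyc fun n => ?_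
  obtain ⟨k, hnk, hbond⟩ := hS.exists_thick_stage hD hcyc hthick n
  obtain ⟨m, hkm, w, hw₂, hw⟩ := hS.exists_winding_stage hD hcyc hC hinf k
  obtain ⟨b, hb, hnb⟩ :=
    hcyc.exists_hasWindingNumber (S.F_mem k) (S.F_mem n) (S.bond_mem hD hnk.le)
  refine ⟨m, hnk.trans_le hkm, ?_, w * b, hw₂.trans (Nat.le_mul_of_pos_right w hb), ?_⟩ <;>
    rw [← S.bond_comp hnk.le hkm]
  · exact hbond.comp_confluent (hcyc.2 _ (S.F_mem m) _ (S.F_mem k) _ (S.bond_mem hD hkm))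
  · exact hcyc.hasWindingNumber_comp (S.F_mem m) (S.F_mem k) (S.F_mem n) (S.bond_mem hD hkm)
      (S.bond_mem hD hnk.le) hw hnb

end IsLimiting

end InverseSequence

end GraphClass

end FraisseCycles

theorem mainTheorem12_general (D : FraisseCycles.GraphClass.{u})
    (hD : D.IsProjectiveFraisse) (hcyc : D.IsClassOfCycles)
    (hthick : D.HasThickPreimages) (hne : D.obj.Nonempty) :
    (∃ K : FraisseCycles.TopGraph.{u}, D.IsProjectiveFraisseLimit K) ∧
    ∀ K : FraisseCycles.TopGraph.{v}, D.IsProjectiveFraisseLimit K →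
      ∃ htrans : ∀ a b c, K.Adj a b → K.Adj b c → K.Adj a c,
        FraisseCycles.IsSolenoid (K.Realization htrans) ∧
        ((∃ C ∈ D.obj, (D.windingNumbersOnto C).Infinite) →
          FraisseCycles.IsNontrivialSolenoid (K.Realization htrans)) := by
  refine ⟨hD.exists_isProjectiveFraisseLimit hne, ?_⟩
  rintro K ⟨S, hKS, hS⟩
  obtain ⟨w, hw, hreal⟩ := hS.exists_realizesAs_one_le hD hcyc hthick
  have hrealK := hreal.of_isomorphic hKS
  refine ⟨hrealK.adj_trans, ⟨w, hw, hrealK.nonempty_homeomorph _⟩, ?_⟩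
  rintro ⟨C, hC, hinf⟩
  obtain ⟨w', hw', hreal'⟩ := hS.exists_realizesAs_two_le hD hcyc hthick hC hinf
  exact ⟨w', hw', (hreal'.of_isomorphic hKS).nonempty_homeomorph _⟩

theorem mainTheorem12 (D : FraisseCycles.GraphClass.{u})
    (hD : D.IsProjectiveFraisse) (hcyc : D.IsClassOfCycles)
    (hthick : D.HasThickPreimages) (hW : D.windingNumbers.Infinite) :
    (∃ K : FraisseCycles.TopGraph.{u}, D.IsProjectiveFraisseLimit K) ∧
    ∀ K : FraisseCycles.TopGraph.{v}, D.IsProjectiveFraisseLimit K →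
      ∃ htrans : ∀ a b c, K.Adj a b → K.Adj b c → K.Adj a c,
        FraisseCycles.IsSolenoid (K.Realization htrans) ∧
        ((∃ C ∈ D.obj, (D.windingNumbersOnto C).Infinite) →
          FraisseCycles.IsNontrivialSolenoid (K.Realization htrans)) := by
  obtain ⟨_, C, hC, -⟩ := hW.nonempty
  exact mainTheorem12_general D hD hcyc hthick ⟨C, hC⟩
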